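/- **Theorem.** Let $X\neq\{0\}$ and $Y$ be Banach spaces over $\mathbb K\in\{\mathbb R,\mathbb C\}$, and let $\mathbb T=\{\theta\in\mathbb K:|\theta|=1\}$. $B$ and $S$ denote closed unit balls and unit spheres. *Definitions.* $\mathrm{NA}(X)\subseteq X^*$ is the set of functionals attaining their norm on $B_X$; $\mathrm{smo}(X^*)$ is the set of points of Gâteaux differentiability of the norm of $X^*$; $\mathrm{SE}(B_X)$ is the set of $x^*\in X^*\setminus\{0\}$ for which there is $x_0\in B_X$ with $\operatorname{Re}x^*(x_0)=\sup_{B_X}\operatorname{Re}x^*$ and such that $x_n\in B_X$, $\operatorname{Re}x^*(x_n)\to \operatorname{Re}x^*(x_0)$ imply $\|x_n-x_0\|\to0$. An operator $T\in\mathcal L(X,Y)$ is *ASE* (resp. *RSE*) if there is $x_0\in S_X$ such that every sequence $(x_n)\subseteq B_X$ with $\|Tx_n\|\to\|T\|$ has a subsequence with $x_{\sigma(n)}\to\theta x_0$ (resp. $Tx_{\sigma(n)}\to\theta Tx_0$) in norm for some $\theta\in\mathbb T$. $T$ is *Dunford–Pettis* if it maps weakly convergent sequences to norm convergent ones. For $\Gamma_0\subseteq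 Y^*$, $T$ is *$\Gamma_0$-flat* if for every nonempty relatively weak$^*$-open $U\subseteq\Gamma_0$ and $\varepsilon>0$ there is a nonempty relatively weak$^*$-open $V\subseteq U$ with $\operatorname{diam}T^*(V)<\varepsilon$. $Y$ has *quasi-ACK structure with $\Gamma$ and $\rho$*, where $\Gamma\subseteq B_{Y^*}$ is $1$-norming (i.e. $\|y\|=\sup_{y^*\in\Gamma}|y^*(y)|$ for all $y$) and $\rho:\Gamma\to[0,1)$, if for every $e^*\in\operatorname{ext}(B_{Y^*})$ there is $\Gamma_{e^*}\subseteq\Gamma$ such that (i) $e^*\in\overline{\mathbb T\,\Gamma_{e^*}}^{w^*}$; (ii) $\sup_{\Gamma_{e^*}}\rho<1$; (iii) for every $\varepsilon>0$ and every nonempty relatively $w^*$-open $U\subseteq\Gamma_{e^*}$ there are a nonempty $V\subseteq U$, $y_1^*\in V$, $e\in S_Y$ and $F\in\mathcal L(Y)$ with $\|F(e)\|=\|F\|=1$, $y_1^*(F(e))=1$, $F^*y_1^*=y_1^*$, $|y^*(F(e))|\le\rho(y_1^*)$ for all $y^*\in\Gamma$ with $\|F^*y^*\|+(1-\varepsilon)\|y^*-F^*y^*\|>1$,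 $\operatorname{dist}(F^*y^*,\operatorname{aco}(\{0\}\cup V))<\varepsilon$ for all $y^*\in\Gamma$ (aco is the absolutely convex hull), and $|v^*(e)-1|\le\varepsilon$ for all $v^*\in V$. $Y$ has *property quasi-$\beta$* if there are $A\subseteq S_{Y^*}$, $\sigma:A\to S_Y$ and $\rho:A\to\mathbb R$ such that $a(\sigma(a))=1$ and $\rho(a)<1$ for $a\in A$, $|b(\sigma(a))|\le\rho(a)$ for distinct $a,b\in A$, and for every $e^*\in\operatorname{ext}(B_{Y^*})$ there are $A_{e^*}\subseteq A$ and $t\in\mathbb T$ with $te^*\in\overline{A_{e^*}}^{w^*}$ and $\sup_{A_{e^*}}\rho<1$. An *operator ideal* $\mathcal I$ assigns to all Banach spaces $W,Z$ a linear subspace $\mathcal I(W,Z)\subseteq\mathcal L(W,Z)$ (not necessarily closed) containing the finite-rank operators, so that compositions of members of $\mathcal I$ with bounded operators on either side belong to $\mathcal I$. *Claim.* 1. Suppose $Y$ has quasi-ACK structure with $\Gamma$ and $\rho$, and let $T\in\mathcal L(X,Y)$ be $\Gamma_0$-flat for every $\Gamma_0\subseteq\Gamma$. (a) If $\mathrm{SE}(B_X)$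 is dense in $X^*$, then for every $\varepsilon>0$ there is an ASE operator $R\in\mathcal L(X,Y)$ with $\|R-T\|<\varepsilon$. (b) If $\mathrm{smo}(X^*)\cap\mathrm{NA}(X)$ is dense in $X^*$, then for every $\varepsilon>0$ there are $R\in\mathcal L(X,Y)$ and $x_0\in S_X$ with $\|R-T\|<\varepsilon$ and $\|Rx_0\|=\|R\|$, such that every sequence $(x_n)\subseteq B_X$ with $\|Rx_n\|\to\|R\|$ has a subsequence converging weakly to $\theta x_0$ for some $\theta\in\mathbb T$. 2. If $\mathrm{smo}(X^*)\cap\mathrm{NA}(X)$ is dense in $X^*$, $Y$ has property quasi-$\beta$, and $\mathcal I$ is an operator ideal such that every member of $\mathcal I(X,Y)$ is Dunford–Pettis, then every $T\in\mathcal I(X,Y)$ is a norm limit of RSE operators belonging to $\mathcal I(X,Y)$. 3. Let $Y$ be (isometric to) a closed subspace of $c_0(\Lambda)$ for some set $\Lambda$. If $Y\ne\{0\}$, then $Y$ has property quasi-$\beta$; and, also for $Y=\{0\}$, if $\mathrm{smo}(X^*)\cap\mathrm{NA}(X)$ is dense in $X^*$ and every member of $\mathcal I(X,Y)$ is Dunford–Pettis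 for an operator ideal $\mathcal I$, then every $T\in\mathcal I(X,Y)$ is a norm limit of RSE operators belonging to $\mathcal I(X,Y)$. -/

import Mathlib

open Filter Topology

universe u v

/-! ### Norm attainment, strongly exposing functionals, smooth points -/

section NormAttainment

variable {𝕜 : Type*} [RCLike 𝕜]
  {X : Type*} [NormedAddCommGroup X] [NormedSpace 𝕜 X]
  {Y : Type*} [NormedAddCommGroup Y] [NormedSpace 𝕜 Y]

/-- `T` attains its norm on the closed unit ball. -/
def IsNormAttaining (T : X →L[𝕜] Y) : Prop :=
  ∃ x : X, ‖x‖ ≤ 1 ∧ ‖T x‖ = ‖T‖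

/-- The sequence `x` converges weakly to `x₀`. -/
def WeaklyConvergesTo (𝕜 : Type*) [RCLike 𝕜] {X : Type*} [NormedAddCommGroup X]
    [NormedSpace 𝕜 X] (x : ℕ → X) (x₀ : X) : Prop :=
  Tendsto (fun n => toWeakSpace 𝕜 X (x n)) atTop (𝓝 (toWeakSpace 𝕜 X x₀))

/-- Absolutely strongly exposing (ASE) operators. -/
def IsASE (T : X →L[𝕜] Y) : Prop :=
  ∃ x₀ : X, ‖x₀‖ = 1 ∧
    ∀ x : ℕ → X, (∀ n, ‖x n‖ ≤ 1) → Tendsto (fun n => ‖T (x n)‖) atTop (𝓝 ‖T‖) →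
      ∃ s : ℕ → ℕ, StrictMono s ∧ ∃ θ : 𝕜, ‖θ‖ = 1 ∧
        Tendsto (fun n => x (s n)) atTop (𝓝 (θ • x₀))

/-- Range strongly exposing (RSE) operators. -/
def IsRSE (T : X →L[𝕜] Y) : Prop :=
  ∃ x₀ : X, ‖x₀‖ = 1 ∧
    ∀ x : ℕ → X, (∀ n, ‖x n‖ ≤ 1) → Tendsto (fun n => ‖T (x n)‖) atTop (𝓝 ‖T‖) →
      ∃ s : ℕ → ℕ, StrictMono s ∧ ∃ θ : 𝕜, ‖θ‖ = 1 ∧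
        Tendsto (fun n => T (x (s n))) atTop (𝓝 (θ • T x₀))

/-- Dunford-Pettis operators: weakly convergent sequences are sent to norm convergent ones. -/
def IsDunfordPettis (T : X →L[𝕜] Y) : Prop :=
  ∀ (x : ℕ → X) (x₀ : X), WeaklyConvergesTo 𝕜 x x₀ →
    Tendsto (fun n => T (x n)) atTop (𝓝 (T x₀))

/-- `SE(C)`: the functionals that strongly expose some point of `C`. -/
def stronglyExposingFunctionals (C : Set X) : Set (StrongDual 𝕜 X) :=
  {f | f ≠ 0 ∧ ∃ x₀ ∈ C, (∀ x ∈ C, RCLike.re (f x) ≤ RCLike.re (f x₀)) ∧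
    ∀ x : ℕ → X, (∀ n, x n ∈ C) →
      Tendsto (fun n => RCLike.re (f (x n))) atTop (𝓝 (RCLike.re (f x₀))) →
      Tendsto x atTop (𝓝 x₀)}

/-- `smo(E)`: the points at which the norm of `E` is Gâteaux differentiable. -/
def smoothPoints (𝕜 : Type*) [RCLike 𝕜] (E : Type*) [NormedAddCommGroup E]
    [NormedSpace 𝕜 E] : Set E :=
  {x | ∀ h : E, ∃ l : ℝ,
    Tendsto (fun t : ℝ => (‖x + (t : 𝕜) • h‖ - ‖x‖) / t) (𝓝[≠] 0) (𝓝 l)}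

/-- `NA(X)`: the norm-attaining functionals on `X`. -/
def normAttainingFunctionals (𝕜 : Type*) [RCLike 𝕜] (X : Type*) [NormedAddCommGroup X]
    [NormedSpace 𝕜 X] : Set (StrongDual 𝕜 X) :=
  {f | IsNormAttaining f}

end NormAttainment

/-! ### Openly fragmented maps and flat operators -/

/-- A map from a topological space to a metric space is openly fragmented if every nonempty open
set contains nonempty open sets whose images have arbitrarily small diameter. -/
def OpenlyFragmented {S M : Type*} [TopologicalSpace S] [PseudoMetricSpace M] (f : S → M) : Prop :=
  ∀ U : Set S, IsOpen U → U.Nonempty → ∀ ε : ℝ, 0 < ε →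
    ∃ V : Set S, V ⊆ U ∧ IsOpen V ∧ V.Nonempty ∧ Metric.ediam (f '' V) < ENNReal.ofReal ε

/-- `T` is `Γ`-flat: the restriction of the adjoint `T*` (i.e. `φ ↦ φ ∘ T`) to `Γ`, with the
weak-star topology on `Γ` and the norm topology on `X*`, is openly fragmented. -/
def IsFlat {𝕜 : Type*} [RCLike 𝕜]
    {X : Type*} [NormedAddCommGroup X] [NormedSpace 𝕜 X]
    {Y : Type*} [NormedAddCommGroup Y] [NormedSpace 𝕜 Y]
    (T : X →L[𝕜] Y) (Γ : Set (StrongDual 𝕜 Y)) : Prop :=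
  OpenlyFragmented
    (fun φ : (StrongDual.toWeakDual '' Γ : Set (WeakDual 𝕜 Y)) =>
      ((WeakDual.toStrongDual φ.1 : StrongDual 𝕜 Y).comp T : StrongDual 𝕜 X))

/-! ### Quasi-ACK structure and property quasi-β -/

section RangeSpaces

variable (𝕜 : Type*) [RCLike 𝕜] (Y : Type*) [NormedAddCommGroup Y] [NormedSpace 𝕜 Y]

/-- `ext(B_{Y*})`. -/
def dualBallExtremePoints : Set (StrongDual 𝕜 Y) :=
  Set.extremePoints ℝ (Metric.closedBall (0 : StrongDual 𝕜 Y) 1)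

variable {𝕜 Y}

/-- `e` lies in the weak-star closure of `𝕋 A`, where `𝕋` is the set of scalars of modulus one. -/
def InWeakStarClosureRotations (e : StrongDual 𝕜 Y) (A : Set (StrongDual 𝕜 Y)) : Prop :=
  StrongDual.toWeakDual e ∈
    closure (StrongDual.toWeakDual '' {φ | ∃ θ : 𝕜, ‖θ‖ = 1 ∧ ∃ a ∈ A, φ = θ • a})

/-- The absolutely convex hull over `𝕜`: the convex hull of the balanced hull. -/
def absolutelyConvexHull (A : Set (StrongDual 𝕜 Y)) : Set (StrongDual 𝕜 Y) :=
  convexHull ℝ (balancedHull 𝕜 A)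

/-- `Γ` is a `1`-norming subset of the dual unit ball. -/
def IsOneNorming (Γ : Set (StrongDual 𝕜 Y)) : Prop :=
  (∀ φ ∈ Γ, ‖φ‖ ≤ 1) ∧ ∀ y : Y, IsLUB {r : ℝ | ∃ φ ∈ Γ, r = ‖φ y‖} ‖y‖

/-- `Y` has quasi-ACK structure with the `1`-norming set `Γ` and the function `ρ : Γ → [0, 1)`
(only the values of `ρ` on `Γ` matter). The adjoint `F*` is `φ ↦ φ ∘ F`. -/
structure HasQuasiACKStructure (Γ : Set (StrongDual 𝕜 Y)) (ρ : StrongDual 𝕜 Y → ℝ) : Prop where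
  norming : IsOneNorming Γ
  rho_mem : ∀ φ ∈ Γ, 0 ≤ ρ φ ∧ ρ φ < 1
  exists_subset : ∀ e' ∈ dualBallExtremePoints 𝕜 Y, ∃ Γe ⊆ Γ,
    InWeakStarClosureRotations e' Γe ∧
    (∃ r : ℝ, r < 1 ∧ ∀ φ ∈ Γe, ρ φ ≤ r) ∧
    ∀ ε : ℝ, 0 < ε → ∀ O : Set (WeakDual 𝕜 Y), IsOpen O →
      (Γe ∩ StrongDual.toWeakDual ⁻¹' O).Nonempty →
      ∃ V : Set (StrongDual 𝕜 Y), V.Nonempty ∧ V ⊆ Γe ∩ StrongDual.toWeakDual ⁻¹' O ∧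
      ∃ φ₁ ∈ V, ∃ e : Y, ‖e‖ = 1 ∧ ∃ F : Y →L[𝕜] Y,
        ‖F e‖ = 1 ∧ ‖F‖ = 1 ∧
        φ₁ (F e) = 1 ∧
        φ₁.comp F = φ₁ ∧
        (∀ φ ∈ Γ \ {ψ | ψ ∈ Γ ∧ ‖ψ.comp F‖ + (1 - ε) * ‖ψ - ψ.comp F‖ ≤ 1},
          ‖φ (F e)‖ ≤ ρ φ₁) ∧
        (∀ φ ∈ Γ, Metric.infDist (φ.comp F) (absolutelyConvexHull (𝕜 := 𝕜) ({0} ∪ V)) < ε) ∧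
        (∀ ψ ∈ V, ‖ψ e - 1‖ ≤ ε)

variable (𝕜 Y)

/-- Property quasi-β: there are a set `A` of norm-one functionals, norm-one vectors `σ a` (`a ∈ A`)
and a function `ρ` on `A` such that `a (σ a) = 1`, `|b (σ a)| ≤ ρ a < 1` for `b ≠ a`, and every
extreme point of the dual ball is, up to a rotation, in the weak-star closure of a subset of `A`
on which `ρ` is bounded away from `1`. -/
def HasPropertyQuasiBeta : Prop :=
  ∃ (A : Set (StrongDual 𝕜 Y)) (σ : StrongDual 𝕜 Y → Y) (ρ : StrongDual 𝕜 Y → ℝ),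
    (∀ a ∈ A, ‖a‖ = 1 ∧ ‖σ a‖ = 1 ∧ a (σ a) = 1 ∧ ρ a < 1) ∧
    (∀ a ∈ A, ∀ b ∈ A, b ≠ a → ‖b (σ a)‖ ≤ ρ a) ∧
    ∀ e' ∈ dualBallExtremePoints 𝕜 Y, ∃ Ae ⊆ A,
      (∃ t : 𝕜, ‖t‖ = 1 ∧
        StrongDual.toWeakDual (t • e') ∈ closure (StrongDual.toWeakDual '' Ae)) ∧
      ∃ r : ℝ, r < 1 ∧ ∀ a ∈ Ae, ρ a ≤ r

end RangeSpaces

/-! ### Operator ideals -/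

/-- An operator ideal (not necessarily closed): for all Banach spaces `X`, `Y` over `𝕜`, a linear
subspace of the bounded operators from `X` to `Y` which contains the finite-rank operators and is
stable under composition with bounded operators on both sides. Domain and range spaces may live
in different universes. -/
structure OperatorIdeal (𝕜 : Type*) [RCLike 𝕜] where
  component : ∀ (X : Type u) (Y : Type v)
    [NormedAddCommGroup X] [NormedSpace 𝕜 X] [CompleteSpace X]
    [NormedAddCommGroup Y] [NormedSpace 𝕜 Y] [CompleteSpace Y], Submodule 𝕜 (X →L[𝕜] Y)
  finiteRank_mem : ∀ (X : Type u) (Y : Type v)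
    [NormedAddCommGroup X] [NormedSpace 𝕜 X] [CompleteSpace X]
    [NormedAddCommGroup Y] [NormedSpace 𝕜 Y] [CompleteSpace Y] (T : X →L[𝕜] Y),
    FiniteDimensional 𝕜 (LinearMap.range (T : X →ₗ[𝕜] Y)) → T ∈ component X Y
  comp_mem : ∀ (W X : Type u) (Y Z : Type v)
    [NormedAddCommGroup W] [NormedSpace 𝕜 W] [CompleteSpace W]
    [NormedAddCommGroup X] [NormedSpace 𝕜 X] [CompleteSpace X]
    [NormedAddCommGroup Y] [NormedSpace 𝕜 Y] [CompleteSpace Y]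
    [NormedAddCommGroup Z] [NormedSpace 𝕜 Z] [CompleteSpace Z]
    (S : W →L[𝕜] X) (T : X →L[𝕜] Y) (R : Y →L[𝕜] Z),
    T ∈ component X Y → R.comp (T.comp S) ∈ component W Z

/-!
All three parts rest on one construction. An operator `R` *peaks along* a functional `g` if, on the
unit ball, `‖g x‖ ≤ ‖R x‖` and `‖R x‖ ≤ max ‖g x‖ m` for some `m < ‖g‖` (`PeaksAlong`). Then
`‖R‖ = ‖g‖` and every sequence norming `R` norms `g`; so up to rotations and subsequences it
converges to the point exposed by `g`, in norm if `g` is strongly exposing and weakly if `g` attains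
its norm and is a smooth point (Šmulian's test). If `R` is moreover Dunford-Pettis, weak convergence
gives norm convergence of the images. It remains to approximate `T` by operators peaking along
members of the given dense set of functionals.

The first step is a small rank-one perturbation after which the adjoint of `T` attains its norm at an
extreme point `e'` of the dual ball (`exists_smulRight_adjoint_attains`). It follows from Lau's
theorem on farthest points (`exists_extreme_farthest`): for generic `y`, every subgradient at `y` of
the distance from `-y` to the farthest point of `T(B_X)` computes this distance, hence the
subdifferential is a weak-star compact face of the dual ball and contains an extreme point.
Using a rank-one perturbation keeps `T` in a given operator ideal, and keeps it flat.

Both structures on `Y` describe a set of functionals that approximates `e'` weak-star, on which the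
norm of the adjoint is therefore almost maximal by lower semicontinuity.

* For a quasi-ACK structure, flatness gives a weak-star open piece of that set which the adjoint maps
  into a small ball around some `T*φ₁`. For `g` near `T*φ₁`, the operator
  `x ↦ g x • F e + (1 - η) • (T x - F (T x))` is close to `T`, because the adjoint of `F` maps the
  norming set near the absolutely convex hull of that piece, and it peaks along `g`
  (`peakOperator_peaksAlong`).
* For property quasi-β, one picks `a` with `‖T*a‖` almost maximal and `g` near `(1 + η) T*a`, and
  replaces `T*a` by `g` through a rank-one operator in the direction `σ a`; this changes the other
  functionals by at most `ρ a < 1` times as much (`peaksAlong_add_smulRight`).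

For a subspace of `c₀`, an extreme functional dominated by the supremum of a family of coordinates is
a rotation of one of them: by Hahn-Banach it factors through `c₀`, whose dual is an `ℓ₁`-sum
(`exists_eq_smul_coord_of_norm_le`). Hence every extreme functional strictly dominates all the
others at some vector (`exists_peak_vector`), which is property quasi-β for a set of representatives
of the extreme functionals modulo rotation.
-/

/-! ### Extreme points of the dual ball -/

section Duality

variable {𝕜 : Type*} [RCLike 𝕜]
  {X : Type*} [NormedAddCommGroup X] [NormedSpace 𝕜 X]
  {Y : Type*} [NormedAddCommGroup Y] [NormedSpace 𝕜 Y]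

theorem re_apply_le_of_norm_le_one {φ : StrongDual 𝕜 Y} (hφ : ‖φ‖ ≤ 1) (y : Y) :
    RCLike.re (φ y) ≤ ‖y‖ :=
  (RCLike.re_le_norm _).trans (φ.le_of_opNorm_le hφ y |>.trans_eq (one_mul _))

theorem norm_apply_le_of_norm_le_one {Z : Type*} [NormedAddCommGroup Z] [NormedSpace 𝕜 Z]
    {T : Y →L[𝕜] Z} (hT : ‖T‖ ≤ 1) (y : Y) : ‖T y‖ ≤ ‖y‖ :=
  T.le_of_opNorm_le hT y |>.trans_eq (one_mul _)

theorem exists_norm_eq_one_mul_eq_norm (c : 𝕜) : ∃ θ : 𝕜, ‖θ‖ = 1 ∧ θ * c = (‖c‖ : 𝕜) := by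
  obtain ⟨θ, h1, h2⟩ := RCLike.exists_norm_eq_mul_self c
  exact ⟨θ, h1, h2.symm⟩

/-- The space `Y*` with its weak-star topology is locally convex as a real vector space. -/
theorem locallyConvexSpace_weakDual : LocallyConvexSpace ℝ (WeakDual 𝕜 Y) := by
  let f : WeakDual 𝕜 Y →ₗ[ℝ] (Y → 𝕜) :=
    { toFun := fun φ y => φ y
      map_add' := fun _ _ => rfl
      map_smul' := fun _ _ => rfl }
  exact LocallyConvexSpace.induced f

/-- A nonempty weak-star closed face of the dual ball contains an extreme point of the ball. -/
theorem exists_mem_dualBallExtremePoints {S : Set (StrongDual 𝕜 Y)} (hne : S.Nonempty)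
    (hcl : IsClosed (WeakDual.toStrongDual ⁻¹' S : Set (WeakDual 𝕜 Y)))
    (hS : IsExtreme ℝ (Metric.closedBall (0 : StrongDual 𝕜 Y) 1) S) :
    ∃ φ ∈ S, φ ∈ dualBallExtremePoints 𝕜 Y := by
  have := locallyConvexSpace_weakDual (𝕜 := 𝕜) (Y := Y)
  have hK : IsCompact (WeakDual.toStrongDual ⁻¹' S : Set (WeakDual 𝕜 Y)) :=
    (WeakDual.isCompact_closedBall (𝕜 := 𝕜) (E := Y) 0 1).of_isClosed_subset hcl
      fun φ hφ => hS.subset hφ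
  obtain ⟨φ, hφ⟩ := hK.extremePoints_nonempty hne
  refine ⟨WeakDual.toStrongDual φ, hφ.1, hS.extremePoints_subset_extremePoints ⟨hφ.1, ?_⟩⟩
  intro a ha b hb hab
  exact hφ.2 (x₁ := StrongDual.toWeakDual a) ha (x₂ := StrongDual.toWeakDual b) hb hab

theorem isOpen_setOf_lt_norm_apply (y : Y) (c : ℝ) :
    IsOpen {φ : WeakDual 𝕜 Y | c < ‖φ y‖} :=
  isOpen_lt continuous_const (WeakDual.eval_continuous y).norm

theorem isClosed_setOf_norm_le_one :
    IsClosed (WeakDual.toStrongDual ⁻¹' {φ : StrongDual 𝕜 Y | ‖φ‖ ≤ 1}) := by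
  have := WeakDual.isClosed_closedBall (𝕜 := 𝕜) (E := Y) 0 1
  simpa [Metric.closedBall, dist_zero_right] using this

/-- The functionals in the dual ball that norm a given vector form a face of the ball. -/
theorem exists_dualBallExtremePoints_apply_eq (y : Y) :
    ∃ φ ∈ dualBallExtremePoints 𝕜 Y, RCLike.re (φ y) = ‖y‖ := by
  suffices h : ∃ φ ∈ {φ : StrongDual 𝕜 Y | ‖φ‖ ≤ 1 ∧ RCLike.re (φ y) = ‖y‖},
      φ ∈ dualBallExtremePoints 𝕜 Y by
    obtain ⟨φ, hφ, h⟩ := h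
    exact ⟨φ, h, hφ.2⟩
  apply exists_mem_dualBallExtremePoints
  · obtain ⟨g, hg, h⟩ := exists_dual_vector'' 𝕜 y
    exact ⟨g, hg, by simp [h]⟩
  · exact isClosed_setOf_norm_le_one.inter
      (isClosed_eq (RCLike.continuous_re.comp (WeakDual.eval_continuous y)) continuous_const)
  · refine ⟨fun φ hφ => by simpa using hφ.1, ?_⟩
    rintro u hu v hv φ ⟨-, hφ⟩ ⟨a, b, ha, hb, hab, rfl⟩
    rw [mem_closedBall_zero_iff] at hu hv
    refine ⟨hu, le_antisymm (re_apply_le_of_norm_le_one hu y) ?_⟩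
    have h2 := re_apply_le_of_norm_le_one hv y
    have h3 : a * RCLike.re (u y) + b * RCLike.re (v y) = ‖y‖ := by
      rw [← hφ]; simp [RCLike.smul_re]
    obtain rfl : b = 1 - a := by linarith
    nlinarith

/-! ### Farthest distance functions -/

/-- The distance from `-y` to the farthest point of `D`. -/
noncomputable def farthestDist (D : Set Y) (y : Y) : ℝ :=
  sSup ((fun d => ‖y + d‖) '' D)

/-- The subdifferential at `y` of the farthest distance function, within the dual ball. -/
def farthestSubdifferential (𝕜 : Type*) [RCLike 𝕜] {Y : Type*} [NormedAddCommGroup Y]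
    [NormedSpace 𝕜 Y] (D : Set Y) (y : Y) : Set (StrongDual 𝕜 Y) :=
  {φ | ‖φ‖ ≤ 1 ∧ ∀ w, farthestDist D y + RCLike.re (φ (w - y)) ≤ farthestDist D w}

variable {D : Set Y}

theorem norm_add_le_farthestDist (hD : Bornology.IsBounded D) (y : Y) {d : Y} (hd : d ∈ D) :
    ‖y + d‖ ≤ farthestDist D y := by
  obtain ⟨C, hC⟩ := hD.exists_norm_le
  refine le_csSup ⟨‖y‖ + C, ?_⟩ ⟨d, hd, rfl⟩
  rintro _ ⟨d, hd, rfl⟩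
  exact (norm_add_le _ _).trans (by gcongr; exact hC d hd)

theorem exists_lt_norm_add (hne : D.Nonempty) (y : Y) {c : ℝ} (hc : c < farthestDist D y) :
    ∃ d ∈ D, c < ‖y + d‖ := by
  obtain ⟨_, ⟨d, hd, rfl⟩, h⟩ := exists_lt_of_lt_csSup (hne.image _) hc
  exact ⟨d, hd, h⟩

theorem farthestDist_le_add (hD : Bornology.IsBounded D) (hne : D.Nonempty) (y w : Y) :
    farthestDist D y ≤ farthestDist D w + ‖y - w‖ := by
  refine csSup_le (hne.image _) ?_
  rintro _ ⟨d, hd, rfl⟩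
  calc ‖y + d‖ = ‖(w + d) + (y - w)‖ := by congr 1; abel
    _ ≤ ‖w + d‖ + ‖y - w‖ := norm_add_le _ _
    _ ≤ _ := by gcongr; exact norm_add_le_farthestDist hD w hd

theorem farthestSubdifferential_nonempty (hD : Bornology.IsBounded D) (hne : D.Nonempty) (y : Y) :
    (farthestSubdifferential 𝕜 D y).Nonempty := by
  -- approximate subgradients are supporting functionals of `y + d` for almost farthest `d`
  let C : ℕ → Set (WeakDual 𝕜 Y) := fun n =>
    (WeakDual.toStrongDual ⁻¹' {φ : StrongDual 𝕜 Y | ‖φ‖ ≤ 1}) ∩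
      ⋂ w, {φ | farthestDist D y + RCLike.re (φ (w - y)) ≤ farthestDist D w + 1 / ((n : ℝ) + 1)}
  have hclosed : ∀ n, IsClosed (C n) := fun n =>
    isClosed_setOf_norm_le_one.inter <| isClosed_iInter fun w =>
      isClosed_le (continuous_const.add
        (RCLike.continuous_re.comp (WeakDual.eval_continuous (w - y)))) continuous_const
  have hCne : ∀ n, (C n).Nonempty := by
    intro n
    obtain ⟨d, hd, h⟩ := exists_lt_norm_add hne y
      (c := farthestDist D y - 1 / ((n : ℝ) + 1))
      (by linarith [Nat.one_div_pos_of_nat (α := ℝ) (n := n)])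
    obtain ⟨g, hg, hgy⟩ := exists_dual_vector'' 𝕜 (y + d)
    refine ⟨StrongDual.toWeakDual g, hg, Set.mem_iInter.2 fun w => ?_⟩
    have h1 : RCLike.re (g (y + d)) = ‖y + d‖ := by simp [hgy]
    have h2 := re_apply_le_of_norm_le_one hg (w + d)
    have h3 := norm_add_le_farthestDist hD w hd
    have h4 : RCLike.re (g (w + d)) = RCLike.re (g (y + d)) + RCLike.re (g (w - y)) := by
      rw [← map_add, ← map_add]; congr 2; abel
    change farthestDist D y + RCLike.re (g (w - y)) ≤ _
    linarith
  obtain ⟨φ, hφ⟩ := IsCompact.nonempty_iInter_of_sequence_nonempty_isCompact_isClosed C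
    (fun n φ hφ => ⟨hφ.1, Set.mem_iInter.2 fun w => by
      have h1 := Set.mem_iInter.1 hφ.2 w
      have h2 := Nat.one_div_le_one_div (α := ℝ) (Nat.le_succ n)
      rw [Set.mem_ofPred_eq] at h1 ⊢
      linarith⟩) hCne
    ((WeakDual.isCompact_closedBall (𝕜 := 𝕜) (E := Y) 0 1).of_isClosed_subset (hclosed 0)
      fun φ hφ => by simpa using hφ.1) hclosed
  rw [Set.mem_iInter] at hφ
  refine ⟨WeakDual.toStrongDual φ, (hφ 0).1, fun w => ?_⟩
  refine le_of_forall_pos_lt_add fun ε hε => ?_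
  obtain ⟨n, hn⟩ := exists_nat_one_div_lt hε
  have := Set.mem_iInter.1 (hφ n).2 w
  change farthestDist D y + RCLike.re (φ (w - y)) ≤ _ at this
  change farthestDist D y + RCLike.re (φ (w - y)) < _
  linarith

theorem isClosed_farthestSubdifferential (D : Set Y) (y : Y) :
    IsClosed (WeakDual.toStrongDual ⁻¹' farthestSubdifferential 𝕜 D y) := by
  have : (WeakDual.toStrongDual ⁻¹' farthestSubdifferential 𝕜 D y : Set (WeakDual 𝕜 Y)) =
      (WeakDual.toStrongDual ⁻¹' {φ : StrongDual 𝕜 Y | ‖φ‖ ≤ 1}) ∩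
      ⋂ w, {φ | farthestDist D y + RCLike.re (φ (w - y)) ≤ farthestDist D w} := by
    ext φ; simp [farthestSubdifferential]
  rw [this]
  exact isClosed_setOf_norm_le_one.inter <| isClosed_iInter fun w =>
      isClosed_le (continuous_const.add
        (RCLike.continuous_re.comp (WeakDual.eval_continuous (w - y)))) continuous_const

/-- Moving from `y₀` straight away from an almost farthest point `d` makes every subgradient
nearby almost attain the farthest distance. -/
theorem dense_interior_setOf_subgradient_almost_attains (hD : Bornology.IsBounded D)
    (hne : D.Nonempty) {δ : ℝ} (hδ : 0 < δ) :
    Dense (interior {y : Y | ∀ φ ∈ farthestSubdifferential 𝕜 D y,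
      ∃ d ∈ D, farthestDist D y - δ < RCLike.re (φ (y + d))}) := by
  rw [Metric.dense_iff]
  intro y₀ r hr
  set h := farthestDist D with hh
  -- `l` is the step length, `s` the radius around the endpoint
  obtain ⟨l, hl0, hl1, hlr, hlδ⟩ : ∃ l : ℝ, 0 < l ∧ l ≤ 1 ∧ l * (|h y₀| + 1) < r ∧
      l * (|h y₀| + 1) < δ / 8 := by
    have hM : 0 < |h y₀| + 1 := by positivity
    refine ⟨min 1 (min (r / (2 * (|h y₀| + 1))) (δ / (16 * (|h y₀| + 1)))), by positivity,
      min_le_left _ _, ?_, ?_⟩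
    · calc _ ≤ (r / (2 * (|h y₀| + 1))) * (|h y₀| + 1) := by
            gcongr; exact (min_le_right _ _).trans (min_le_left _ _)
        _ = r / 2 := by field_simp
        _ < r := by linarith
    · calc _ ≤ (δ / (16 * (|h y₀| + 1))) * (|h y₀| + 1) := by
            gcongr; exact (min_le_right _ _).trans (min_le_right _ _)
        _ = δ / 16 := by field_simp
        _ < _ := by linarith
  obtain ⟨d, hd, hdd⟩ := exists_lt_norm_add hne y₀ (c := h y₀ - l * δ / 16)
    (by have : 0 < l * δ := by positivity
        linarith)
  have hle := norm_add_le_farthestDist hD y₀ hd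
  set y₁ := y₀ + (l : 𝕜) • (y₀ + d) with hy₁
  have hdist : ‖y₁ - y₀‖ = l * ‖y₀ + d‖ := by
    rw [hy₁, add_sub_cancel_left, norm_smul, RCLike.norm_ofReal, abs_of_pos hl0]
  have hdist' : ‖y₁ - y₀‖ ≤ l * (|h y₀| + 1) := by
    rw [hdist]; gcongr; linarith [le_abs_self (h y₀)]
  refine ⟨y₁, by rw [Metric.mem_ball, dist_eq_norm]; linarith, ?_⟩
  rw [mem_interior_iff_mem_nhds, Metric.mem_nhds_iff]
  refine ⟨l * δ / 16, by positivity, fun y hy φ hφ => ⟨d, hd, ?_⟩⟩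
  rw [Metric.mem_ball, dist_eq_norm] at hy
  have h1 : h y + RCLike.re (φ (y₀ - y)) ≤ h y₀ := hφ.2 y₀
  have h2 : RCLike.re (φ (y₀ - y)) =
      -(l * RCLike.re (φ (y₀ + d))) - RCLike.re (φ (y - y₁)) := by
    have : y₀ - y = -((l : 𝕜) • (y₀ + d)) - (y - y₁) := by rw [hy₁]; abel
    rw [this, map_sub, map_neg, map_smul, map_sub, map_neg, smul_eq_mul, RCLike.re_ofReal_mul]
  have h3 := re_apply_le_of_norm_le_one hφ.1 (y - y₁)
  have h4 : h y₁ ≤ h y + ‖y₁ - y‖ := farthestDist_le_add hD hne _ _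
  rw [norm_sub_rev] at h4
  have h5 : (1 + l) * ‖y₀ + d‖ ≤ h y₁ := by
    have := norm_add_le_farthestDist hD y₁ hd
    have e : y₁ + d = ((1 + l : ℝ) : 𝕜) • (y₀ + d) := by
      rw [hy₁]; push_cast; rw [add_smul, one_smul]; abel
    rw [e, norm_smul, RCLike.norm_ofReal, abs_of_pos (by linarith)] at this
    exact this
  have h6 : h y₀ - δ / 4 ≤ RCLike.re (φ (y₀ + d)) := by
    have : l * (h y₀ - δ / 4) ≤ l * RCLike.re (φ (y₀ + d)) := by nlinarith
    exact le_of_mul_le_mul_left this hl0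
  have h7 := re_apply_le_of_norm_le_one hφ.1 (y₀ - y)
  have h8 : RCLike.re (φ (y₀ + d)) = RCLike.re (φ (y + d)) + RCLike.re (φ (y₀ - y)) := by
    rw [← map_add, ← map_add]; congr 2; abel
  have h9 : ‖y₀ - y‖ ≤ ‖y₁ - y₀‖ + ‖y - y₁‖ := by
    rw [norm_sub_rev]
    calc ‖y - y₀‖ = ‖(y₁ - y₀) + (y - y₁)‖ := by congr 1; abel
      _ ≤ _ := norm_add_le _ _
  have h10 : h y ≤ h y₀ + ‖y - y₀‖ := farthestDist_le_add hD hne _ _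
  rw [norm_sub_rev] at h10
  have h11 : l * δ / 16 ≤ δ / 16 := by nlinarith
  linarith

/-- For a generic translation of a bounded set, the farthest distance is the supremum over the
set of the real part of one extreme functional. At such a translation the subdifferential
is a face of the dual ball. -/
theorem exists_extreme_farthest [CompleteSpace Y] (hD : Bornology.IsBounded D) (hne : D.Nonempty)
    {ε : ℝ} (hε : 0 < ε) :
    ∃ y : Y, ‖y‖ < ε ∧ ∃ φ ∈ dualBallExtremePoints 𝕜 Y, ∀ δ > 0, ∃ d ∈ D,
      farthestDist D y - δ < RCLike.re (φ (y + d)) := by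
  have hdense := dense_iInter_of_isOpen_nat (fun _ => isOpen_interior) fun n : ℕ =>
    dense_interior_setOf_subgradient_almost_attains (𝕜 := 𝕜) hD hne
      (δ := 1 / ((n : ℝ) + 1)) Nat.one_div_pos_of_nat
  obtain ⟨y, hyε, hy⟩ := Metric.dense_iff.1 hdense 0 ε hε
  rw [mem_ball_zero_iff] at hyε
  have hgood : ∀ φ ∈ farthestSubdifferential 𝕜 D y, ∀ δ > 0, ∃ d ∈ D,
      farthestDist D y - δ < RCLike.re (φ (y + d)) := by
    intro φ hφ δ hδ
    obtain ⟨n, hn⟩ := exists_nat_one_div_lt hδ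
    obtain ⟨d, hd, h⟩ := interior_subset (Set.mem_iInter.1 hy n) φ hφ
    exact ⟨d, hd, by linarith⟩
  suffices h : ∃ φ ∈ farthestSubdifferential 𝕜 D y, φ ∈ dualBallExtremePoints 𝕜 Y by
    obtain ⟨φ, hφ, h⟩ := h
    exact ⟨y, hyε, φ, h, hgood φ hφ⟩
  apply exists_mem_dualBallExtremePoints
    (farthestSubdifferential_nonempty (𝕜 := 𝕜) hD hne y)
    (isClosed_farthestSubdifferential D y)
  refine ⟨fun φ hφ => by simpa using hφ.1, ?_⟩
  rintro u hu v hv φ hφ ⟨a, b, ha, hb, hab, rfl⟩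
  rw [mem_closedBall_zero_iff] at hu hv
  refine ⟨hu, fun w => le_of_forall_pos_lt_add fun δ hδ => ?_⟩
  obtain ⟨d, hd, h⟩ := hgood _ hφ (a * δ) (by positivity)
  have h1 : RCLike.re ((a • u + b • v) (y + d)) =
      a * RCLike.re (u (y + d)) + b * RCLike.re (v (y + d)) := by
    simp only [add_apply, smul_apply, map_add, RCLike.smul_re]
    ring
  have h2 := (re_apply_le_of_norm_le_one hv (y + d)).trans (norm_add_le_farthestDist hD y hd)
  have h3 : farthestDist D y - δ < RCLike.re (u (y + d)) := by
    obtain rfl : b = 1 - a := by linarith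
    rw [h1] at h
    have : a * (farthestDist D y - δ) < a * RCLike.re (u (y + d)) := by nlinarith
    exact lt_of_mul_lt_mul_left this ha.le
  have h4 := (re_apply_le_of_norm_le_one hu (w + d)).trans (norm_add_le_farthestDist hD w hd)
  have h5 : RCLike.re (u (w + d)) = RCLike.re (u (y + d)) + RCLike.re (u (w - y)) := by
    rw [← map_add, ← map_add]; congr 2; abel
  linarith

end Duality

/-! ### Rank-one perturbations whose adjoint attains its norm at an extreme point -/

section AdjointAttaining

variable {𝕜 : Type*} [RCLike 𝕜]
  {X : Type*} [NormedAddCommGroup X] [NormedSpace 𝕜 X]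
  {Y : Type*} [NormedAddCommGroup Y] [NormedSpace 𝕜 Y]

theorem opNorm_le_of_closedBall {T : X →L[𝕜] Y} {C : ℝ} (hC : 0 ≤ C)
    (h : ∀ x, ‖x‖ ≤ 1 → ‖T x‖ ≤ C) : ‖T‖ ≤ C :=
  T.opNorm_le_of_unit_norm (𝕜 := 𝕜) hC fun x hx => h x hx.le

theorem exists_lt_norm_apply_of_lt_opNorm (T : X →L[𝕜] Y) {c : ℝ} (hc : c < ‖T‖) :
    ∃ x, ‖x‖ ≤ 1 ∧ c < ‖T x‖ := by
  obtain ⟨x, hx, h⟩ := T.exists_lt_apply_of_lt_opNorm hc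
  exact ⟨x, hx.le, h⟩

/-- A functional aligned with `g`, normalised so that adding `c` times it increases the norm of
`g` as much as possible. -/
theorem exists_norm_add_smul_eq [Nontrivial X] (g : StrongDual 𝕜 X) (c : 𝕜) :
    ∃ f : StrongDual 𝕜 X, ‖f‖ ≤ 1 ∧ ‖g + c • f‖ = ‖g‖ + ‖c‖ := by
  rcases eq_or_ne g 0 with rfl | hg
  · obtain ⟨f, hf, -⟩ := exists_dual_vector' 𝕜 (0 : X)
    exact ⟨f, hf.le, by simp [norm_smul, hf]⟩
  · obtain ⟨θ, hθ, h⟩ := exists_norm_eq_one_mul_eq_norm c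
    have hg' : (‖g‖ : ℝ) ≠ 0 := norm_ne_zero_iff.2 hg
    have hg'' : (‖g‖ : 𝕜) ≠ 0 := by exact_mod_cast hg'
    refine ⟨(θ * (‖g‖ : 𝕜)⁻¹) • g, by simp [norm_smul, hθ, hg'], ?_⟩
    have : g + c • (θ * (‖g‖ : 𝕜)⁻¹) • g = ((1 + ‖c‖ * ‖g‖⁻¹ : ℝ) : 𝕜) • g := by
      ext x
      simp only [add_apply, smul_apply, smul_eq_mul]
      push_cast
      simp only [RCLike.algebraMap_eq_ofReal, ← h]
      ring
    rw [this, norm_smul, RCLike.norm_ofReal, abs_of_nonneg (by positivity)]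
    field_simp

/-- A bound for all translates of a vector by unimodular multiples of `y` holds for all
translates by multiples of modulus at most one. -/
theorem norm_add_smul_le_of_unimodular {z y : Y} {C : ℝ}
    (h : ∀ θ : 𝕜, ‖θ‖ = 1 → ‖z + θ • y‖ ≤ C) {c : 𝕜} (hc : ‖c‖ ≤ 1) : ‖z + c • y‖ ≤ C := by
  obtain ⟨θ, hθ, hcθ⟩ : ∃ θ : 𝕜, ‖θ‖ = 1 ∧ c = (‖c‖ : 𝕜) * θ := by
    obtain ⟨θ, hθ, h⟩ := exists_norm_eq_one_mul_eq_norm c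
    have h0 : θ ≠ 0 := norm_ne_zero_iff.1 (by rw [hθ]; exact one_ne_zero)
    refine ⟨θ⁻¹, by simp [hθ], ?_⟩
    rw [← h]; field_simp
  have h1 := h θ hθ
  have h2 := h (-θ) (by simpa)
  have e : z + c • y = (((1 + ‖c‖) / 2 : ℝ) : 𝕜) • (z + θ • y)
      + (((1 - ‖c‖) / 2 : ℝ) : 𝕜) • (z + (-θ) • y) := by
    conv_lhs => rw [hcθ]
    push_cast
    module
  rw [e]
  refine (norm_add_le _ _).trans ?_
  rw [norm_smul, norm_smul, RCLike.norm_ofReal, RCLike.norm_ofReal,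
    abs_of_nonneg (by positivity), abs_of_nonneg (by linarith)]
  nlinarith [norm_nonneg c]

/-- Every operator has arbitrarily small rank-one perturbations whose adjoint attains its norm
at an extreme point of the dual ball. If the extreme functional `φ` computes the farthest distance
between `-y` and `T(B_X)`, then perturbing by `y` times a functional aligned with `T*φ` works. -/
theorem exists_smulRight_adjoint_attains [Nontrivial X] [CompleteSpace Y] (T : X →L[𝕜] Y)
    {ε : ℝ} (hε : 0 < ε) :
    ∃ (f : StrongDual 𝕜 X) (y : Y), ‖f.smulRight y‖ < ε ∧ ∃ φ ∈ dualBallExtremePoints 𝕜 Y,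
      ‖φ.comp (T + f.smulRight y)‖ = ‖T + f.smulRight y‖ := by
  have hD : Bornology.IsBounded (T '' Metric.closedBall 0 1) :=
    T.lipschitz.isBounded_image Metric.isBounded_closedBall
  have hne : (T '' Metric.closedBall (0 : X) 1).Nonempty := ⟨T 0, 0, by simp, rfl⟩
  obtain ⟨y, hy, φ, hφ, hfar⟩ := exists_extreme_farthest (𝕜 := 𝕜) hD hne hε
  obtain ⟨f, hf, hfφ⟩ := exists_norm_add_smul_eq (φ.comp T) (φ y)
  have hφ1 : ‖φ‖ ≤ 1 := by simpa using hφ.1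
  refine ⟨f, y, ?_, φ, hφ, le_antisymm ?_ ?_⟩
  · rw [ContinuousLinearMap.norm_smulRight_apply]
    exact (mul_le_of_le_one_left (norm_nonneg _) hf).trans_lt hy
  · exact (φ.opNorm_comp_le _).trans (mul_le_of_le_one_left (norm_nonneg _) hφ1)
  · have e : φ.comp (T + f.smulRight y) = φ.comp T + φ y • f := by
      ext x; simp [mul_comm]
    have hmax : farthestDist (T '' Metric.closedBall 0 1) y ≤ ‖φ.comp T‖ + ‖φ y‖ := by
      refine le_of_forall_pos_lt_add fun δ hδ => ?_
      obtain ⟨_, ⟨x, hx, rfl⟩, h⟩ := hfar δ hδ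
      rw [mem_closedBall_zero_iff] at hx
      have h1 : ‖φ (T x)‖ ≤ ‖φ.comp T‖ := (φ.comp T).unit_le_opNorm x hx
      have h2 : RCLike.re (φ (y + T x)) ≤ ‖φ y‖ + ‖φ (T x)‖ := by
        rw [map_add]; exact (RCLike.re_le_norm _).trans (norm_add_le _ _)
      linarith
    rw [e, hfφ]
    refine opNorm_le_of_closedBall (by positivity) fun x hx => ?_
    simp only [add_apply, ContinuousLinearMap.smulRight_apply]
    refine norm_add_smul_le_of_unimodular (fun θ hθ => ?_) ((f.unit_le_opNorm x hx).trans hf)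
    have h0 : θ ≠ 0 := norm_ne_zero_iff.1 (by rw [hθ]; exact one_ne_zero)
    have e2 : T x + θ • y = θ • (y + T (θ⁻¹ • x)) := by
      rw [smul_add, map_smul, smul_smul, mul_inv_cancel₀ h0, one_smul, add_comm]
    rw [e2, norm_smul, hθ, one_mul]
    exact (norm_add_le_farthestDist hD y
      ⟨θ⁻¹ • x, by simpa [norm_smul, hθ] using hx, rfl⟩).trans hmax

end AdjointAttaining

/-! ### Operators peaking along one functional -/

section Peak

variable {𝕜 : Type*} [RCLike 𝕜]
  {X : Type*} [NormedAddCommGroup X] [NormedSpace 𝕜 X]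
  {Y : Type*} [NormedAddCommGroup Y] [NormedSpace 𝕜 Y]

/-- On the unit ball, the norm of `R x` agrees with `‖g x‖` wherever it exceeds some level below
`‖g‖`. -/
def PeaksAlong (R : X →L[𝕜] Y) (g : StrongDual 𝕜 X) : Prop :=
  ∃ m < ‖g‖, ∀ x, ‖x‖ ≤ 1 → ‖g x‖ ≤ ‖R x‖ ∧ ‖R x‖ ≤ max ‖g x‖ m

variable {R : X →L[𝕜] Y} {g : StrongDual 𝕜 X}

theorem PeaksAlong.norm_eq (h : PeaksAlong R g) : ‖R‖ = ‖g‖ := by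
  obtain ⟨m, hm, h⟩ := h
  refine le_antisymm ?_ ?_
  · exact opNorm_le_of_closedBall (norm_nonneg _) fun x hx =>
      (h x hx).2.trans (max_le (g.unit_le_opNorm x hx) hm.le)
  · exact opNorm_le_of_closedBall (norm_nonneg _) fun x hx =>
      (h x hx).1.trans (R.unit_le_opNorm x hx)

theorem PeaksAlong.tendsto (h : PeaksAlong R g) {x : ℕ → X} (hx : ∀ n, ‖x n‖ ≤ 1)
    (hR : Tendsto (fun n => ‖R (x n)‖) atTop (𝓝 ‖R‖)) :
    Tendsto (fun n => ‖g (x n)‖) atTop (𝓝 ‖g‖) := by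
  have hn := h.norm_eq
  obtain ⟨m, hm, h⟩ := h
  rw [hn] at hR
  refine hR.congr' ?_
  filter_upwards [hR.eventually (lt_mem_nhds hm)] with n hmn
  rcases le_max_iff.1 (h _ (hx n)).2 with h1 | h1
  · exact le_antisymm h1 (h _ (hx n)).1
  · exact absurd h1 hmn.not_ge

/-- A sequence norming `g` can be rotated so that `g` is real and positive along it; the inverse
rotations subconverge. -/
theorem exists_rotation_subseq (g : StrongDual 𝕜 X) {x : ℕ → X}
    (hg : Tendsto (fun n => ‖g (x n)‖) atTop (𝓝 ‖g‖)) :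
    ∃ (u : ℕ → 𝕜) (s : ℕ → ℕ) (θ : 𝕜), StrictMono s ∧ ‖θ‖ = 1 ∧ (∀ n, ‖u n‖ = 1) ∧
      Tendsto (fun n => RCLike.re (g (u n • x n))) atTop (𝓝 ‖g‖) ∧
      Tendsto (fun n => (u (s n))⁻¹) atTop (𝓝 θ) := by
  choose u hu hux using fun n => exists_norm_eq_one_mul_eq_norm (g (x n))
  obtain ⟨θ, hθ, s, hs, hlim⟩ := (isCompact_sphere (0 : 𝕜) 1).tendsto_subseq
    (x := fun n => (u n)⁻¹) fun n => by simp [hu]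
  refine ⟨u, s, θ, hs, by simpa using hθ, hu, ?_, hlim⟩
  simpa [hux] using hg

theorem PeaksAlong.isASE (h : PeaksAlong R g)
    (hg : g ∈ stronglyExposingFunctionals (𝕜 := 𝕜) (Metric.closedBall (0 : X) 1)) : IsASE R := by
  obtain ⟨hg0, x₀, hx₀, hmax, hexp⟩ := hg
  rw [mem_closedBall_zero_iff] at hx₀
  have hre : RCLike.re (g x₀) = ‖g‖ := by
    refine le_antisymm ((RCLike.re_le_norm _).trans (g.unit_le_opNorm x₀ hx₀)) ?_
    refine opNorm_le_of_closedBall ?_ fun x hx => ?_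
    · simpa using hmax 0 (by simp)
    · obtain ⟨θ, hθ, h⟩ := exists_norm_eq_one_mul_eq_norm (g x)
      have := hmax (θ • x) (by simpa [norm_smul, hθ] using hx)
      simpa [h] using this
  have hx₀1 : ‖x₀‖ = 1 := by
    refine le_antisymm hx₀ ?_
    have h1 := (RCLike.re_le_norm (g x₀)).trans (g.le_opNorm x₀)
    rw [hre] at h1
    have := norm_pos_iff.2 hg0
    exact le_of_mul_le_mul_left (by simpa using h1) this
  refine ⟨x₀, hx₀1, fun x hx hR => ?_⟩
  obtain ⟨u, s, θ, hs, hθ, hu, hlim, hus⟩ := exists_rotation_subseq g (h.tendsto hx hR)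
  refine ⟨s, hs, θ, hθ, ?_⟩
  have h1 := hexp (fun n => u n • x n) (fun n => by simpa [norm_smul, hu] using hx n)
    (by rw [hre]; exact hlim)
  refine (hus.smul (h1.comp hs.tendsto_atTop)).congr fun n => ?_
  have h0 : u (s n) ≠ 0 := norm_ne_zero_iff.1 (by rw [hu]; exact one_ne_zero)
  simp [smul_smul, h0]

/-- Šmulian's test: if the dual norm is Gâteaux differentiable at `g`, the real parts of all
functionals converge along sequences maximising the real part of `g`. -/
theorem exists_tendsto_re_of_smoothPoints (hg : g ∈ smoothPoints 𝕜 (StrongDual 𝕜 X))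
    (f : StrongDual 𝕜 X) : ∃ l : ℝ, ∀ x : ℕ → X, (∀ n, ‖x n‖ ≤ 1) →
      Tendsto (fun n => RCLike.re (g (x n))) atTop (𝓝 ‖g‖) →
      Tendsto (fun n => RCLike.re (f (x n))) atTop (𝓝 l) := by
  obtain ⟨l, hl⟩ := hg f
  refine ⟨l, fun x hx hlim => ?_⟩
  have key : ∀ (t : ℝ) (n : ℕ),
      RCLike.re (g (x n)) + t * RCLike.re (f (x n)) ≤ ‖g + (t : 𝕜) • f‖ := by
    intro t n
    have h1 := (RCLike.re_le_norm _).trans ((g + (t : 𝕜) • f).unit_le_opNorm (x n) (hx n))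
    simpa using h1
  have hpos : Tendsto (fun t : ℝ => (‖g + (t : 𝕜) • f‖ - ‖g‖) / t) (𝓝[>] 0) (𝓝 l) :=
    hl.mono_left (nhdsWithin_mono _ fun t ht => ne_of_gt ht)
  have hneg : Tendsto (fun t : ℝ => (‖g + (t : 𝕜) • f‖ - ‖g‖) / t) (𝓝[<] 0) (𝓝 l) :=
    hl.mono_left (nhdsWithin_mono _ fun t ht => ne_of_lt ht)
  rw [tendsto_order]
  constructor
  · intro a ha
    obtain ⟨t, hta, ht⟩ := ((hneg.eventually (lt_mem_nhds ha)).and self_mem_nhdsWithin).exists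
    have ht : t < 0 := ht
    rw [lt_div_iff_of_neg ht] at hta
    have h2 : ‖g + (t : 𝕜) • f‖ - a * t < ‖g‖ := by linarith
    filter_upwards [hlim.eventually (lt_mem_nhds h2)] with n hn
    have := key t n
    nlinarith
  · intro a ha
    obtain ⟨t, hta, ht⟩ := ((hpos.eventually (gt_mem_nhds ha)).and self_mem_nhdsWithin).exists
    have ht : 0 < t := ht
    rw [div_lt_iff₀ ht] at hta
    have h2 : ‖g + (t : 𝕜) • f‖ - a * t < ‖g‖ := by linarith
    filter_upwards [hlim.eventually (lt_mem_nhds h2)] with n hn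
    have := key t n
    nlinarith

/-- A norm-attaining functional at which the dual norm is Gâteaux differentiable weakly exposes
the point where it attains its norm. -/
theorem tendsto_apply_of_smoothPoints (hg : g ∈ smoothPoints 𝕜 (StrongDual 𝕜 X)) {x₀ : X}
    (hx₀ : ‖x₀‖ ≤ 1) (hgx₀ : g x₀ = (‖g‖ : 𝕜)) {x : ℕ → X} (hx : ∀ n, ‖x n‖ ≤ 1)
    (hlim : Tendsto (fun n => RCLike.re (g (x n))) atTop (𝓝 ‖g‖)) (f : StrongDual 𝕜 X) :
    Tendsto (fun n => f (x n)) atTop (𝓝 (f x₀)) := by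
  have hre : ∀ f : StrongDual 𝕜 X,
      Tendsto (fun n => RCLike.re (f (x n))) atTop (𝓝 (RCLike.re (f x₀))) := by
    intro f
    obtain ⟨l, hl⟩ := exists_tendsto_re_of_smoothPoints hg f
    have h0 := hl (fun _ => x₀) (fun _ => hx₀) (by simp [hgx₀])
    rw [tendsto_nhds_unique tendsto_const_nhds h0]
    exact hl x hx hlim
  -- the imaginary part of `f` is the real part of `-i f`
  have him : Tendsto (fun n => RCLike.im (f (x n))) atTop (𝓝 (RCLike.im (f x₀))) := by
    simpa using hre (-(RCLike.I : 𝕜) • f)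
  have := ((RCLike.continuous_ofReal (K := 𝕜)).tendsto _ |>.comp (hre f)).add
    (((RCLike.continuous_ofReal (K := 𝕜)).tendsto _ |>.comp him).mul_const RCLike.I)
  simpa [Function.comp_def, RCLike.re_add_im] using this

theorem weaklyConvergesTo_iff {x : ℕ → X} {x₀ : X} : WeaklyConvergesTo 𝕜 x x₀ ↔
    ∀ f : StrongDual 𝕜 X, Tendsto (fun n => f (x n)) atTop (𝓝 (f x₀)) :=
  WeakBilin.tendsto_iff_forall_eval_tendsto (topDualPairing 𝕜 X).flip <| by
    intro a b hab
    by_contra hne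
    obtain ⟨f, -, hf⟩ := exists_dual_vector 𝕜 (a - b) (norm_ne_zero_iff.2 (sub_ne_zero.2 hne))
    have h1 : f a = f b := DFunLike.congr_fun hab f
    rw [map_sub, h1, sub_self, eq_comm, RCLike.ofReal_eq_zero] at hf
    exact norm_ne_zero_iff.2 (sub_ne_zero.2 hne) hf

theorem PeaksAlong.exists_weakly_convergent_subseq (h : PeaksAlong R g) (hg0 : g ≠ 0)
    (hsmo : g ∈ smoothPoints 𝕜 (StrongDual 𝕜 X)) (hNA : g ∈ normAttainingFunctionals 𝕜 X) :
    ∃ x₀ : X, ‖x₀‖ = 1 ∧ ‖R x₀‖ = ‖R‖ ∧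
      ∀ x : ℕ → X, (∀ n, ‖x n‖ ≤ 1) → Tendsto (fun n => ‖R (x n)‖) atTop (𝓝 ‖R‖) →
        ∃ s : ℕ → ℕ, StrictMono s ∧ ∃ θ : 𝕜, ‖θ‖ = 1 ∧
          WeaklyConvergesTo 𝕜 (fun n => x (s n)) (θ • x₀) := by
  obtain ⟨z, hz, hgz⟩ := hNA
  obtain ⟨θ₀, hθ₀, hzθ⟩ := exists_norm_eq_one_mul_eq_norm (g z)
  have hx₀ : ‖θ₀ • z‖ ≤ 1 := by simpa [norm_smul, hθ₀] using hz
  have hgx₀ : g (θ₀ • z) = (‖g‖ : 𝕜) := by rw [map_smul, smul_eq_mul, hzθ, hgz]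
  have hgn : ‖g (θ₀ • z)‖ = ‖g‖ := by rw [hgx₀]; simp
  refine ⟨θ₀ • z, le_antisymm hx₀ ?_, le_antisymm (R.unit_le_opNorm _ hx₀) ?_, fun x hx hR => ?_⟩
  · have h1 := g.le_opNorm (θ₀ • z)
    rw [hgn] at h1
    exact le_of_mul_le_mul_left (by simpa using h1) (norm_pos_iff.2 hg0)
  · rw [h.norm_eq, ← hgn]
    obtain ⟨m, -, h⟩ := h
    exact (h _ hx₀).1
  obtain ⟨u, s, θ, hs, hθ, hu, hlim, hus⟩ := exists_rotation_subseq g (h.tendsto hx hR)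
  refine ⟨s, hs, θ, hθ, weaklyConvergesTo_iff.2 fun f => ?_⟩
  have h1 := tendsto_apply_of_smoothPoints hsmo hx₀ hgx₀ (x := fun n => u n • x n)
    (fun n => by simpa [norm_smul, hu] using hx n) hlim f
  rw [map_smul f θ]
  refine (hus.smul (h1.comp hs.tendsto_atTop)).congr fun n => ?_
  have h0 : u (s n) ≠ 0 := norm_ne_zero_iff.1 (by rw [hu]; exact one_ne_zero)
  simp [h0]

end Peak

/-! ### Flat operators -/

section Flat

variable {𝕜 : Type*} [RCLike 𝕜]
  {X : Type*} [NormedAddCommGroup X] [NormedSpace 𝕜 X]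
  {Y : Type*} [NormedAddCommGroup Y] [NormedSpace 𝕜 Y]

/-- Flatness in terms of weak-star open subsets of the whole dual. -/
theorem IsFlat.exists_isOpen {T : X →L[𝕜] Y} {Γ : Set (StrongDual 𝕜 Y)} (hT : IsFlat T Γ)
    {O : Set (WeakDual 𝕜 Y)} (hO : IsOpen O) (hne : (Γ ∩ StrongDual.toWeakDual ⁻¹' O).Nonempty)
    {ε : ℝ} (hε : 0 < ε) :
    ∃ O' ⊆ O, IsOpen O' ∧ (Γ ∩ StrongDual.toWeakDual ⁻¹' O').Nonempty ∧
      ∀ φ ∈ Γ, ∀ ψ ∈ Γ, StrongDual.toWeakDual φ ∈ O' → StrongDual.toWeakDual ψ ∈ O' →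
        ‖φ.comp T - ψ.comp T‖ < ε := by
  obtain ⟨φ₀, hφ₀, hφ₀O⟩ := hne
  obtain ⟨V, hVU, hV, ⟨v, hv⟩, hdiam⟩ := hT (Subtype.val ⁻¹' O) (hO.preimage continuous_subtype_val)
    ⟨⟨_, φ₀, hφ₀, rfl⟩, hφ₀O⟩ ε hε
  obtain ⟨W, hW, rfl⟩ := isOpen_induced_iff.1 hV
  refine ⟨W ∩ O, Set.inter_subset_right, hW.inter hO, ?_, ?_⟩
  · obtain ⟨v, φ, hφ, rfl⟩ := v
    exact ⟨φ, hφ, hv, hVU hv⟩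
  · intro φ hφ ψ hψ hφW hψW
    let F : (StrongDual.toWeakDual '' Γ : Set (WeakDual 𝕜 Y)) → StrongDual 𝕜 X := fun φ =>
      (WeakDual.toStrongDual φ.1 : StrongDual 𝕜 Y).comp T
    have h := (Metric.edist_le_ediam_of_mem
      (Set.mem_image_of_mem F (show ⟨_, φ, hφ, rfl⟩ ∈ Subtype.val ⁻¹' W from hφW.1))
      (Set.mem_image_of_mem F (show ⟨_, ψ, hψ, rfl⟩ ∈ Subtype.val ⁻¹' W from hψW.1))).trans_lt hdiam
    rw [edist_dist, ENNReal.ofReal_lt_ofReal_iff hε, dist_eq_norm] at h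
    exact h

/-- Rank-one perturbations keep the neighbourhood form of flatness, since the adjoint of a rank-one
operator is continuous from the weak-star topology to the norm topology. -/
theorem IsFlat.exists_isOpen_add_smulRight {T : X →L[𝕜] Y} {Γ : Set (StrongDual 𝕜 Y)}
    (hT : IsFlat T Γ) (f : StrongDual 𝕜 X) (y : Y)
    {O : Set (WeakDual 𝕜 Y)} (hO : IsOpen O) (hne : (Γ ∩ StrongDual.toWeakDual ⁻¹' O).Nonempty)
    {ε : ℝ} (hε : 0 < ε) :
    ∃ O' ⊆ O, IsOpen O' ∧ (Γ ∩ StrongDual.toWeakDual ⁻¹' O').Nonempty ∧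
      ∀ φ ∈ Γ, ∀ ψ ∈ Γ, StrongDual.toWeakDual φ ∈ O' → StrongDual.toWeakDual ψ ∈ O' →
        ‖φ.comp (T + f.smulRight y) - ψ.comp (T + f.smulRight y)‖ < ε := by
  obtain ⟨φ₀, hφ₀, hφ₀O⟩ := hne
  have hη : 0 < ε / (4 * (‖f‖ + 1)) := by positivity
  have hP : IsOpen {φ : WeakDual 𝕜 Y | ‖φ y - φ₀ y‖ < ε / (4 * (‖f‖ + 1))} :=
    isOpen_lt ((WeakDual.eval_continuous y).sub continuous_const).norm continuous_const
  obtain ⟨O', hO'O, hO', hne', hsmall⟩ := hT.exists_isOpen (hO.inter hP)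
    ⟨φ₀, hφ₀, hφ₀O, by simpa using hη⟩ (half_pos hε)
  refine ⟨O', fun φ hφ => (hO'O hφ).1, hO', hne', fun φ hφ ψ hψ hφO hψO => ?_⟩
  have h1 := hsmall φ hφ ψ hψ hφO hψO
  have h2 : ‖φ y - φ₀ y‖ < ε / (4 * (‖f‖ + 1)) := (hO'O hφO).2
  have h3 : ‖ψ y - φ₀ y‖ < ε / (4 * (‖f‖ + 1)) := (hO'O hψO).2
  have e : φ.comp (T + f.smulRight y) - ψ.comp (T + f.smulRight y)
      = (φ.comp T - ψ.comp T) + (φ y - ψ y) • f := by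
    ext x; simp; ring
  have h4 : ‖φ y - ψ y‖ ≤ 2 * (ε / (4 * (‖f‖ + 1))) := by
    calc ‖φ y - ψ y‖ = ‖(φ y - φ₀ y) - (ψ y - φ₀ y)‖ := by congr 1; ring
      _ ≤ _ := norm_sub_le _ _
      _ ≤ _ := by linarith
  have h5 : ‖φ y - ψ y‖ * ‖f‖ ≤ ε / 2 := by
    calc ‖φ y - ψ y‖ * ‖f‖ ≤ 2 * (ε / (4 * (‖f‖ + 1))) * (‖f‖ + 1) := by
          gcongr; linarith
      _ = ε / 2 := by field_simp; norm_num
  rw [e]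
  refine (norm_add_le _ _).trans_lt ?_
  rw [norm_smul]
  linarith

end Flat

/-! ### Operators into spaces with quasi-ACK structure -/

section QuasiACK

variable {𝕜 : Type*} [RCLike 𝕜]
  {X : Type*} [NormedAddCommGroup X] [NormedSpace 𝕜 X]
  {Y : Type*} [NormedAddCommGroup Y] [NormedSpace 𝕜 Y]

theorem IsOneNorming.norm_le {Γ : Set (StrongDual 𝕜 Y)} (hΓ : IsOneNorming Γ) {y : Y} {c : ℝ}
    (h : ∀ φ ∈ Γ, ‖φ y‖ ≤ c) : ‖y‖ ≤ c :=
  (hΓ.2 y).2 <| by rintro _ ⟨φ, hφ, rfl⟩; exact h φ hφ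

/-- If an extreme functional at which the adjoint of `T` attains its norm is approximated by
rotations of `A`, the adjoint of `T` almost attains its norm on a weak-star open piece of `A`. -/
theorem InWeakStarClosureRotations.exists_isOpen {e' : StrongDual 𝕜 Y}
    {A : Set (StrongDual 𝕜 Y)} (h : InWeakStarClosureRotations e' A) (T : X →L[𝕜] Y) {c : ℝ}
    (hc : c < ‖e'.comp T‖) :
    ∃ O : Set (WeakDual 𝕜 Y), IsOpen O ∧ (A ∩ StrongDual.toWeakDual ⁻¹' O).Nonempty ∧
      ∀ φ, StrongDual.toWeakDual φ ∈ O → c < ‖φ.comp T‖ := by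
  obtain ⟨x, hx, hcx⟩ := exists_lt_norm_apply_of_lt_opNorm _ hc
  have hO : IsOpen {φ : WeakDual 𝕜 Y | c < ‖φ (T x)‖} := isOpen_setOf_lt_norm_apply _ _
  obtain ⟨_, hφO, _, ⟨θ, hθ, a, ha, rfl⟩, rfl⟩ := mem_closure_iff.1 h _ hO hcx
  refine ⟨_, hO, ⟨a, ha, ?_⟩, fun φ hφ => lt_of_lt_of_le hφ ((φ.comp T).unit_le_opNorm x hx)⟩
  have : c < ‖θ * a (T x)‖ := hφO
  simpa [hθ] using this

/-- On the absolutely convex hull of `{0} ∪ V`, the adjoint of `T` is close to the rank-one map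
`φ ↦ φ e • g` as soon as it is so on `V`. -/
theorem norm_comp_sub_smul_le_of_mem_absolutelyConvexHull {T : X →L[𝕜] Y} {e : Y}
    {g : StrongDual 𝕜 X} {V : Set (StrongDual 𝕜 Y)} {C : ℝ} (hC : 0 ≤ C)
    (hV : ∀ v ∈ V, ‖v.comp T - v e • g‖ ≤ C) {ψ : StrongDual 𝕜 Y}
    (hψ : ψ ∈ absolutelyConvexHull (𝕜 := 𝕜) ({0} ∪ V)) : ‖ψ.comp T - ψ e • g‖ ≤ C := by
  suffices h : absolutelyConvexHull (𝕜 := 𝕜) ({0} ∪ V) ⊆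
      {ψ : StrongDual 𝕜 Y | ‖ψ.comp T - ψ e • g‖ ≤ C} from h hψ
  refine convexHull_min (Balanced.balancedHull_subset_of_subset ?_ ?_) ?_
  · rintro c hc _ ⟨φ, hφ, rfl⟩
    have e1 : (c • φ).comp T - (c • φ) e • g = c • (φ.comp T - φ e • g) := by
      ext x; simp; ring
    change ‖(c • φ).comp T - (c • φ) e • g‖ ≤ C
    rw [e1, norm_smul]
    exact (mul_le_of_le_one_left (norm_nonneg _) hc).trans hφ
  · rintro v (rfl | hv)
    · simpa [norm_smul] using hC
    · exact hV v hv
  · intro φ hφ ψ hψ a b ha hb hab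
    have e1 : (a • φ + b • ψ).comp T - (a • φ + b • ψ) e • g
        = a • (φ.comp T - φ e • g) + b • (ψ.comp T - ψ e • g) := by
      ext x; simp [RCLike.real_smul_eq_coe_mul]; ring
    change ‖(a • φ + b • ψ).comp T - (a • φ + b • ψ) e • g‖ ≤ C
    rw [e1]
    have hφ : ‖φ.comp T - φ e • g‖ ≤ C := hφ
    have hψ : ‖ψ.comp T - ψ e • g‖ ≤ C := hψ
    refine (norm_add_le _ _).trans ?_
    rw [norm_smul, norm_smul, Real.norm_of_nonneg ha, Real.norm_of_nonneg hb]
    calc a * ‖φ.comp T - φ e • g‖ + b * ‖ψ.comp T - ψ e • g‖ ≤ a * C + b * C := by gcongr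
      _ = C := by rw [← add_mul, hab, one_mul]

/-- If all of `V` is close to evaluating to `1` at `e` and is mapped by the adjoint of `T` close to
`g`, then near the absolutely convex hull of `{0} ∪ V` the adjoint of `T` is close to the rank-one
map `χ ↦ χ e • g`. -/
theorem norm_comp_sub_smul_le_of_infDist_lt {T : X →L[𝕜] Y} {V : Set (StrongDual 𝕜 Y)}
    {φ₁ χ : StrongDual 𝕜 Y} {e : Y} {g : StrongDual 𝕜 X} {δ : ℝ} (hδ : 0 ≤ δ)
    (hg : ‖g - φ₁.comp T‖ ≤ δ) (hV : ∀ v ∈ V, ‖v.comp T - φ₁.comp T‖ ≤ δ)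
    (hVe : ∀ v ∈ V, ‖v e - 1‖ ≤ δ) (he : ‖e‖ ≤ 1)
    (hχ : Metric.infDist χ (absolutelyConvexHull (𝕜 := 𝕜) ({0} ∪ V)) < δ) :
    ‖χ.comp T - χ e • g‖ ≤ 2 * δ + 2 * δ * ‖g‖ + δ * ‖T‖ := by
  have hne : (absolutelyConvexHull (𝕜 := 𝕜) ({0} ∪ V)).Nonempty :=
    ⟨0, subset_convexHull _ _ (mem_balancedHull_iff.2
      ⟨0, by simp, Set.mem_smul_set.2 ⟨0, Or.inl rfl, by ext; simp⟩⟩)⟩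
  obtain ⟨ψ, hψ, hd⟩ := (Metric.infDist_lt_iff hne).1 hχ
  have hv : ∀ v ∈ V, ‖v.comp T - v e • g‖ ≤ 2 * δ + δ * ‖g‖ := by
    intro v hv
    have e1 : v.comp T - v e • g = (v.comp T - φ₁.comp T) - (g - φ₁.comp T)
        - (v e - 1) • g := by
      ext x; simp; ring
    rw [e1]
    refine (norm_sub_le _ _).trans ?_
    have h1 := norm_sub_le (v.comp T - φ₁.comp T) (g - φ₁.comp T)
    have h2 := hV v hv
    have h3 : ‖(v e - 1) • g‖ ≤ δ * ‖g‖ := by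
      rw [norm_smul]; exact mul_le_mul_of_nonneg_right (hVe v hv) (norm_nonneg _)
    linarith
  have h1 := norm_comp_sub_smul_le_of_mem_absolutelyConvexHull (by positivity) hv hψ
  rw [dist_eq_norm] at hd
  have e2 : χ.comp T - χ e • g = (ψ.comp T - ψ e • g) + ((χ - ψ).comp T - (χ - ψ) e • g) := by
    ext x; simp; ring
  rw [e2]
  have h2 : ‖(χ - ψ).comp T‖ ≤ δ * ‖T‖ :=
    (ContinuousLinearMap.opNorm_comp_le _ _).trans
      (mul_le_mul_of_nonneg_right hd.le (norm_nonneg _))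
  have h3 : ‖(χ - ψ) e • g‖ ≤ δ * ‖g‖ := by
    rw [norm_smul]
    exact mul_le_mul_of_nonneg_right (((χ - ψ).unit_le_opNorm e he).trans hd.le) (norm_nonneg _)
  have h4 := norm_sub_le ((χ - ψ).comp T) ((χ - ψ) e • g)
  have h5 := norm_add_le (ψ.comp T - ψ e • g) ((χ - ψ).comp T - (χ - ψ) e • g)
  linarith

/-- The operator `x ↦ g x • F e + (1 - η) • (T x - F (T x))`: on the range of `F` it replaces `T`
by a rank-one operator, and it shrinks the rest of `T` slightly. -/
noncomputable def peakOperator (T : X →L[𝕜] Y) (F : Y →L[𝕜] Y) (e : Y) (g : StrongDual 𝕜 X)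
    (η : ℝ) : X →L[𝕜] Y :=
  g.smulRight (F e) + ((1 - η : ℝ) : 𝕜) • (T - F.comp T)

theorem apply_peakOperator (T : X →L[𝕜] Y) (F : Y →L[𝕜] Y) (e : Y) (g : StrongDual 𝕜 X)
    (η : ℝ) (φ : StrongDual 𝕜 Y) (x : X) : φ (peakOperator T F e g η x) =
      φ (F e) * g x + (1 - (η : 𝕜)) * (φ (T x) - φ (F (T x))) := by
  simp only [peakOperator, add_apply, ContinuousLinearMap.smulRight_apply, smul_apply, sub_apply,
    ContinuousLinearMap.comp_apply, map_add, map_smul, map_sub, smul_eq_mul, RCLike.ofReal_one]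
  ring

/-- The value of a functional with `‖φ ∘ F‖ + (1 - δ) ‖φ - φ ∘ F‖ ≤ 1` at `peakOperator` is a convex
combination of `‖g x‖` and a smaller level. -/
theorem norm_apply_peakOperator_le_of_split {T : X →L[𝕜] Y} {F : Y →L[𝕜] Y} {e : Y}
    {g : StrongDual 𝕜 X} {η δ : ℝ} {φ : StrongDual 𝕜 Y} (hη1 : η < 1) (hδ1 : δ < 1) (he : ‖e‖ ≤ 1)
    (hφ : ‖φ.comp F‖ + (1 - δ) * ‖φ - φ.comp F‖ ≤ 1) {x : X} (hx : ‖x‖ ≤ 1) :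
    ‖φ (peakOperator T F e g η x)‖ ≤ max ‖g x‖ ((1 - η) * ‖T‖ / (1 - δ)) := by
  have h1δ : 0 < 1 - δ := by linarith
  have h1η : 0 ≤ 1 - η := by linarith
  set q := (1 - η) * ‖T‖ / (1 - δ) with hq
  have hq0 : 0 ≤ q := by positivity
  have e1 : φ (peakOperator T F e g η x)
      = (φ.comp F) e * g x + ((1 - η : ℝ) : 𝕜) * (φ - φ.comp F) (T x) := by
    rw [apply_peakOperator, sub_apply, ContinuousLinearMap.comp_apply,
      ContinuousLinearMap.comp_apply]
    push_cast
    ring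
  rw [e1]
  refine (norm_add_le _ _).trans ?_
  rw [norm_mul, norm_mul, RCLike.norm_ofReal, abs_of_nonneg h1η]
  have h1 : ‖(φ.comp F) e‖ ≤ ‖φ.comp F‖ := (φ.comp F).unit_le_opNorm e he
  have h2 : ‖(φ - φ.comp F) (T x)‖ ≤ ‖φ - φ.comp F‖ * ‖T‖ :=
    (φ - φ.comp F).le_opNorm_of_le (T.unit_le_opNorm x hx)
  have h3 : (1 - η) * ‖(φ - φ.comp F) (T x)‖ ≤ q * (1 - ‖φ.comp F‖) := by
    calc (1 - η) * ‖(φ - φ.comp F) (T x)‖ ≤ (1 - η) * (‖φ - φ.comp F‖ * ‖T‖) :=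
          mul_le_mul_of_nonneg_left h2 h1η
      _ = q * ((1 - δ) * ‖φ - φ.comp F‖) := by rw [hq]; field_simp
      _ ≤ _ := mul_le_mul_of_nonneg_left (by linarith) hq0
  have h4 : 0 ≤ 1 - ‖φ.comp F‖ := by
    have : 0 ≤ (1 - δ) * ‖φ - φ.comp F‖ := by positivity
    linarith
  calc ‖(φ.comp F) e‖ * ‖g x‖ + (1 - η) * ‖(φ - φ.comp F) (T x)‖
      ≤ ‖φ.comp F‖ * max ‖g x‖ q + max ‖g x‖ q * (1 - ‖φ.comp F‖) :=
        add_le_add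
          (mul_le_mul h1 (le_max_left _ _) (norm_nonneg _) (norm_nonneg _))
          (h3.trans (mul_le_mul_of_nonneg_right (le_max_right _ _) h4))
    _ = max ‖g x‖ q := by ring

/-- A functional with `‖φ (F e)‖ ≤ r` sees little of the rank-one part of
`peakOperator`, up to the error `E`. -/
theorem norm_apply_peakOperator_le_of_small {T : X →L[𝕜] Y} {F : Y →L[𝕜] Y} {e : Y}
    {g : StrongDual 𝕜 X} {η r E : ℝ} {φ : StrongDual 𝕜 Y} (hη0 : 0 ≤ η) (hη1 : η ≤ 1)
    (hφ1 : ‖φ‖ ≤ 1) (hr : ‖φ (F e)‖ ≤ r) {x : X} (hx : ‖x‖ ≤ 1)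
    (hE : ‖φ (F (T x)) - φ (F e) * g x‖ ≤ E) :
    ‖φ (peakOperator T F e g η x)‖ ≤ (1 - η) * ‖T‖ + η * (r * ‖g‖) + E := by
  have h1η : 0 ≤ 1 - η := by linarith
  have e1 : φ (peakOperator T F e g η x)
      = ((1 - η : ℝ) : 𝕜) * φ (T x) + (η : 𝕜) * (φ (F e) * g x)
        - ((1 - η : ℝ) : 𝕜) * (φ (F (T x)) - φ (F e) * g x) := by
    rw [apply_peakOperator]; push_cast; ring
  have h0 : ‖φ (T x)‖ ≤ ‖T‖ :=
    (norm_apply_le_of_norm_le_one hφ1 _).trans (T.unit_le_opNorm x hx)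
  have h1 : (1 - η) * ‖φ (T x)‖ ≤ (1 - η) * ‖T‖ := mul_le_mul_of_nonneg_left h0 h1η
  have h2 : η * (‖φ (F e)‖ * ‖g x‖) ≤ η * (r * ‖g‖) :=
    mul_le_mul_of_nonneg_left (mul_le_mul hr (g.unit_le_opNorm x hx) (norm_nonneg _)
      ((norm_nonneg _).trans hr)) hη0
  have h3 : (1 - η) * ‖φ (F (T x)) - φ (F e) * g x‖ ≤ 1 * E :=
    mul_le_mul (by linarith) hE (norm_nonneg _) zero_le_one
  rw [e1]
  refine (norm_sub_le _ _).trans ?_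
  refine (add_le_add_left (norm_add_le _ _) _).trans ?_
  rw [norm_mul, norm_mul, norm_mul, norm_mul, RCLike.norm_ofReal, RCLike.norm_ofReal,
    abs_of_nonneg h1η, abs_of_nonneg hη0]
  linarith

/-- If `φ ∘ F ∘ T` is within `E` of `φ (F e) • g` for all `φ` in a norming set, `peakOperator` is
close to `T`. -/
theorem norm_peakOperator_sub_le {T : X →L[𝕜] Y} {F : Y →L[𝕜] Y} {e : Y}
    {g : StrongDual 𝕜 X} {η E : ℝ} {Γ : Set (StrongDual 𝕜 Y)} (hΓ : IsOneNorming Γ)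
    (hη0 : 0 ≤ η) (hF : ‖F‖ ≤ 1) (hE0 : 0 ≤ E)
    (hE : ∀ φ ∈ Γ, ∀ x, ‖x‖ ≤ 1 → ‖φ (F (T x)) - φ (F e) * g x‖ ≤ E) :
    ‖peakOperator T F e g η - T‖ ≤ E + η * (2 * ‖T‖) := by
  refine opNorm_le_of_closedBall (by positivity) fun x hx => hΓ.norm_le fun φ hφ => ?_
  have h1 := hE φ hφ x hx
  have h2 : ‖φ (T x)‖ ≤ ‖T‖ :=
    (norm_apply_le_of_norm_le_one (hΓ.1 φ hφ) _).trans (T.unit_le_opNorm x hx)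
  have h3 : ‖φ (F (T x))‖ ≤ ‖T‖ :=
    (norm_apply_le_of_norm_le_one (hΓ.1 φ hφ) _).trans
      ((norm_apply_le_of_norm_le_one hF _).trans (T.unit_le_opNorm x hx))
  have e1 : φ ((peakOperator T F e g η - T) x)
      = -(φ (F (T x)) - φ (F e) * g x) - (η : 𝕜) * (φ (T x) - φ (F (T x))) := by
    rw [sub_apply, map_sub, apply_peakOperator]; ring
  rw [e1]
  refine (norm_sub_le _ _).trans ?_
  rw [norm_neg, norm_mul, RCLike.norm_ofReal, abs_of_nonneg hη0]
  have h4 := norm_sub_le (φ (T x)) (φ (F (T x)))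
  have h5 : η * ‖φ (T x) - φ (F (T x))‖ ≤ η * (2 * ‖T‖) :=
    mul_le_mul_of_nonneg_left (by linarith) hη0
  linarith

/-- The data provided by a quasi-ACK structure let `T*φ₁` be replaced by a nearby functional `g`:
`peakOperator` is close to `T` and peaks along `g`. -/
theorem peakOperator_peaksAlong {T : X →L[𝕜] Y} {Γ V : Set (StrongDual 𝕜 Y)}
    {φ₁ : StrongDual 𝕜 Y} {e : Y} {F : Y →L[𝕜] Y} {g : StrongDual 𝕜 X} {r η δ : ℝ}
    (hΓ : IsOneNorming Γ) (hφ₁ : φ₁ ∈ Γ)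
    (hr0 : 0 ≤ r) (hr1 : r < 1) (hη0 : 0 < η) (hη1 : η < 1)
    (hδ : 0 < δ) (hδη : 20 * (1 + ‖T‖) * δ ≤ η * ‖T‖ * (1 - r))
    (hT : 0 < ‖T‖)
    (hφ₁T : ‖T‖ - δ < ‖φ₁.comp T‖) (hg : ‖g - φ₁.comp T‖ ≤ δ)
    (hV : ∀ v ∈ V, ‖v.comp T - φ₁.comp T‖ ≤ δ) (hVe : ∀ v ∈ V, ‖v e - 1‖ ≤ δ)
    (he : ‖e‖ = 1) (hF : ‖F‖ = 1) (hφ₁Fe : φ₁ (F e) = 1) (hφ₁F : φ₁.comp F = φ₁)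
    (hcase : ∀ φ ∈ Γ, ¬ (‖φ.comp F‖ + (1 - δ) * ‖φ - φ.comp F‖ ≤ 1) → ‖φ (F e)‖ ≤ r)
    (hdist : ∀ φ ∈ Γ, Metric.infDist (φ.comp F) (absolutelyConvexHull (𝕜 := 𝕜) ({0} ∪ V)) < δ) :
    ‖peakOperator T F e g η - T‖ ≤ 3 * η * ‖T‖ ∧ PeaksAlong (peakOperator T F e g η) g := by
  set τ := ‖T‖ with hτ
  set κ := ‖g‖ with hκ
  have hκ0 : 0 ≤ κ := norm_nonneg _
  -- both `δ` and the error `E` below are small multiples of `η * τ * (1 - r)`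
  have hητ : η * τ * (1 - r) ≤ η * τ := by
    have : 0 < η * τ := by positivity
    nlinarith
  have hδ1 : 20 * δ ≤ η := by
    have h1 : 20 * δ * (1 + τ) ≤ η * (1 + τ) := by nlinarith
    exact le_of_mul_le_mul_right h1 (by linarith)
  have hδτ : δ * τ + δ ≤ η * τ * (1 - r) / 20 := by linarith
  have hδτ0 : 0 < δ * τ := by positivity
  have hφ₁n : ‖φ₁‖ ≤ 1 := hΓ.1 _ hφ₁
  have hκ1 : κ ≤ τ + δ := by
    have h1 : ‖φ₁.comp T‖ ≤ τ :=
      (φ₁.opNorm_comp_le T).trans (mul_le_of_le_one_left (norm_nonneg _) hφ₁n)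
    have h2 := norm_le_norm_add_norm_sub' g (φ₁.comp T)
    linarith
  have hκ2 : τ - 2 * δ < κ := by
    have h2 := norm_le_norm_add_norm_sub' (φ₁.comp T) g
    rw [norm_sub_rev] at h2
    linarith
  set E := 2 * δ + 2 * δ * κ + δ * τ with hE
  have hE0 : 0 ≤ E := by positivity
  have hE1 : E ≤ 4 * δ + 3 * (δ * τ) := by nlinarith
  have happrox : ∀ φ ∈ Γ, ‖(φ.comp F).comp T - φ (F e) • g‖ ≤ E := fun φ hφ =>
    norm_comp_sub_smul_le_of_infDist_lt hδ.le hg hV hVe he.le (hdist φ hφ)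
  have happrox' : ∀ φ ∈ Γ, ∀ x, ‖x‖ ≤ 1 → ‖φ (F (T x)) - φ (F e) * g x‖ ≤ E := by
    intro φ hφ x hx
    exact (((φ.comp F).comp T - φ (F e) • g).unit_le_opNorm x hx).trans (happrox φ hφ)
  refine ⟨?_, ?_⟩
  · have h1 := norm_peakOperator_sub_le hΓ hη0.le hF.le hE0 happrox'
    rw [← hτ] at h1
    linarith
  · -- the two levels correspond to the two alternatives for a functional of `Γ`
    have h1δ : 0 < 1 - δ := by linarith
    refine ⟨max ((1 - η) * τ / (1 - δ)) ((1 - η) * τ + η * (r * κ) + E), max_lt ?_ ?_,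
      fun x hx => ⟨?_, ?_⟩⟩
    · refine lt_of_lt_of_le ?_ hκ2.le
      rw [div_lt_iff₀ h1δ]
      nlinarith
    · have h1 : (1 - η * r) * (τ - 2 * δ) ≤ (1 - η * r) * κ :=
        mul_le_mul_of_nonneg_left hκ2.le (by nlinarith)
      have h2 : 0 ≤ η * r * δ := by positivity
      nlinarith
    · have h1 : φ₁ (peakOperator T F e g η x) = g x := by
        have h2 : φ₁ (F (T x)) = φ₁ (T x) := DFunLike.congr_fun hφ₁F (T x)
        rw [apply_peakOperator, hφ₁Fe, h2, sub_self, mul_zero, one_mul, add_zero]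
      rw [← h1]
      exact norm_apply_le_of_norm_le_one hφ₁n _
    · refine hΓ.norm_le fun φ hφ => ?_
      by_cases hc : ‖φ.comp F‖ + (1 - δ) * ‖φ - φ.comp F‖ ≤ 1
      · exact (norm_apply_peakOperator_le_of_split hη1 (by linarith) he.le hc hx).trans
          (max_le_max le_rfl (le_max_left _ _))
      · exact le_max_of_le_right (le_max_of_le_right
          (norm_apply_peakOperator_le_of_small hη0.le hη1.le (hΓ.1 φ hφ) (hcase φ hφ hc) hx
            (happrox' φ hφ x hx)))

/-- Flat operators into a space with quasi-ACK structure are approximated by operators peaking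
along functionals from any prescribed dense set. -/
theorem HasQuasiACKStructure.exists_peaksAlong [Nontrivial X] [CompleteSpace Y]
    {Γ : Set (StrongDual 𝕜 Y)} {ρ : StrongDual 𝕜 Y → ℝ} (hY : HasQuasiACKStructure Γ ρ)
    {T : X →L[𝕜] Y} (hT : ∀ Γ₀ ⊆ Γ, IsFlat T Γ₀) {G : Set (StrongDual 𝕜 X)} (hG : Dense G)
    {ε : ℝ} (hε : 0 < ε) :
    ∃ R : X →L[𝕜] Y, ‖R - T‖ < ε ∧ ∃ g ∈ G, g ≠ 0 ∧ PeaksAlong R g := by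
  rcases eq_or_ne T 0 with rfl | hT0
  · -- rank-one operators peak along their functional; `Y` contains a unit vector
    obtain ⟨e, he⟩ : ∃ e : Y, ‖e‖ = 1 := by
      obtain ⟨e', he', -⟩ := exists_dualBallExtremePoints_apply_eq (𝕜 := 𝕜) (0 : Y)
      obtain ⟨Γe, hΓe, hcl, -, hex⟩ := hY.exists_subset e' he'
      obtain ⟨_, -, _, ⟨_, _, a, ha, rfl⟩, rfl⟩ := mem_closure_iff.1 hcl _ isOpen_univ trivial
      obtain ⟨V, -, -, φ₁, -, e, he, -⟩ := hex 1 one_pos Set.univ isOpen_univ ⟨a, ha, trivial⟩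
      exact ⟨e, he⟩
    obtain ⟨f, hf, -⟩ := exists_dual_vector' 𝕜 (0 : X)
    obtain ⟨g, hg, hgG⟩ := Metric.dense_iff.1 hG (((ε / 2 : ℝ) : 𝕜) • f) (ε / 2) (half_pos hε)
    rw [Metric.mem_ball, dist_eq_norm] at hg
    have hn : ‖((ε / 2 : ℝ) : 𝕜) • f‖ = ε / 2 := by
      rw [norm_smul, hf, RCLike.norm_ofReal, mul_one, abs_of_pos (by positivity)]
    have hg0 : g ≠ 0 := by
      rintro rfl
      rw [zero_sub, norm_neg, hn] at hg
      exact lt_irrefl _ hg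
    refine ⟨g.smulRight e, ?_, g, hgG, hg0, 0, norm_pos_iff.2 hg0, fun x _ => ?_⟩
    · rw [sub_zero, ContinuousLinearMap.norm_smulRight_apply, he, mul_one]
      have := norm_le_norm_add_norm_sub' g (((ε / 2 : ℝ) : 𝕜) • f)
      linarith
    · simp [norm_smul, he]
  · have hTn : 0 < ‖T‖ := norm_pos_iff.2 hT0
    obtain ⟨f, y, hfy, e', he', hatt⟩ := exists_smulRight_adjoint_attains T
      (ε := min (ε / 2) ‖T‖) (by positivity)
    set T₁ := T + f.smulRight y with hT₁
    have hT₁0 : 0 < ‖T₁‖ := by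
      have h1 := norm_sub_le T₁ (f.smulRight y)
      rw [hT₁, add_sub_cancel_right, ← hT₁] at h1
      linarith [hfy.trans_le (min_le_right _ _)]
    obtain ⟨Γe, hΓe, hcl, ⟨r₀, hr₀, hρ⟩, hex⟩ := hY.exists_subset e' he'
    set r := max r₀ 0 with hr
    have hr1 : r < 1 := max_lt hr₀ one_pos
    obtain ⟨η, hη0, hη1, hηε⟩ : ∃ η : ℝ, 0 < η ∧ η < 1 ∧ 3 * η * ‖T₁‖ < ε / 2 := by
      refine ⟨min (1 / 2) (ε / (8 * ‖T₁‖)), by positivity,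
        (min_le_left _ _).trans_lt (by norm_num), ?_⟩
      calc 3 * min (1 / 2) (ε / (8 * ‖T₁‖)) * ‖T₁‖ ≤ 3 * (ε / (8 * ‖T₁‖)) * ‖T₁‖ := by
            gcongr; exact min_le_right _ _
        _ = 3 * ε / 8 := by field_simp
        _ < ε / 2 := by linarith
    obtain ⟨δ, hδ0, hδ⟩ : ∃ δ : ℝ, 0 < δ ∧ 20 * (1 + ‖T₁‖) * δ ≤ η * ‖T₁‖ * (1 - r) := by
      have : 0 < 1 - r := by linarith
      refine ⟨η * ‖T₁‖ * (1 - r) / (20 * (1 + ‖T₁‖)), by positivity, le_of_eq ?_⟩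
      field_simp
    obtain ⟨O, hO, hOne, hOT⟩ := hcl.exists_isOpen T₁ (c := ‖T₁‖ - δ) (by rw [hatt]; linarith)
    obtain ⟨O', hO'O, hO', hO'ne, hsmall⟩ :=
      (hT Γe hΓe).exists_isOpen_add_smulRight f y hO hOne hδ0
    obtain ⟨V, -, hVO, φ₁, hφ₁, e, he, F, -, hF, hφ₁Fe, hφ₁F, hcase, hdist, hVe⟩ :=
      hex δ hδ0 O' hO' hO'ne
    obtain ⟨g, hg, hgG⟩ := Metric.dense_iff.1 hG (φ₁.comp T₁) δ hδ0
    rw [Metric.mem_ball, dist_eq_norm] at hg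
    obtain ⟨hRT, hR⟩ := peakOperator_peaksAlong (g := g) hY.norming (hΓe (hVO hφ₁).1)
      (le_max_right _ _) hr1 hη0 hη1 hδ0 hδ hT₁0 (hOT φ₁ (hO'O (hVO hφ₁).2)) hg.le
      (fun v hv => (hsmall v (hVO hv).1 φ₁ (hVO hφ₁).1 (hVO hv).2 (hVO hφ₁).2).le) hVe he hF
      hφ₁Fe hφ₁F
      (fun φ hφ h => (hcase φ ⟨hφ, fun h' => h h'.2⟩).trans
        ((hρ φ₁ (hVO hφ₁).1).trans (le_max_left _ _)))
      hdist
    refine ⟨_, ?_, g, hgG, ?_, hR⟩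
    · set R := peakOperator T₁ F e g η
      have e1 : R - T = (R - T₁) + f.smulRight y := by rw [hT₁]; abel
      rw [e1]
      have h1 := norm_add_le (R - T₁) (f.smulRight y)
      linarith [hfy.trans_le (min_le_left _ _)]
    · rintro rfl
      have h1 := hOT φ₁ (hO'O (hVO hφ₁).2)
      rw [zero_sub, norm_neg] at hg
      -- `δ` is too small compared with `‖T₁‖`
      have h2 : 20 * δ ≤ 20 * (1 + ‖T₁‖) * δ := by nlinarith [mul_pos hT₁0 hδ0]
      have h3 : η * ‖T₁‖ * (1 - r) ≤ ‖T₁‖ := by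
        have : 0 ≤ r := le_max_right _ _
        have h4 : η * (1 - r) ≤ 1 := by nlinarith
        nlinarith
      linarith

end QuasiACK

/-! ### Operators into spaces with property quasi-β -/

section QuasiBeta

variable {𝕜 : Type*} [RCLike 𝕜]
  {X : Type*} [NormedAddCommGroup X] [NormedSpace 𝕜 X]
  {Y : Type*} [NormedAddCommGroup Y] [NormedSpace 𝕜 Y]

/-- Moving `T*a` to a nearby functional `g` of larger norm by a rank-one operator in the direction
`s` changes the other functionals of `A` by a smaller amount, so the result peaks along `g`. -/
theorem peaksAlong_add_smulRight {T : X →L[𝕜] Y} {A : Set (StrongDual 𝕜 Y)} {a : StrongDual 𝕜 Y}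
    {s : Y} {g : StrongDual 𝕜 X} {r : ℝ}
    (hA1 : ∀ b ∈ A, ‖b‖ ≤ 1) (hA : ∀ y : Y, ∀ c : ℝ, (∀ b ∈ A, ‖b y‖ ≤ c) → ‖y‖ ≤ c)
    (ha : a ∈ A) (hs : a s = 1) (hr : ∀ b ∈ A, b ≠ a → ‖b s‖ ≤ r) (hr0 : 0 ≤ r)
    (hg : ‖T‖ + r * ‖g - a.comp T‖ < ‖g‖) :
    PeaksAlong (T + (g - a.comp T).smulRight s) g := by
  have hab : ∀ x, a ((T + (g - a.comp T).smulRight s) x) = g x := fun x => by simp [hs]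
  refine ⟨_, hg, fun x hx => ⟨?_, hA _ _ fun b hb => ?_⟩⟩
  · rw [← hab]
    exact norm_apply_le_of_norm_le_one (hA1 a ha) _
  · by_cases hba : b = a
    · rw [hba, hab]
      exact le_max_left _ _
    · refine le_max_of_le_right ?_
      have e1 : b ((T + (g - a.comp T).smulRight s) x) = b (T x) + (g - a.comp T) x * b s := by
        simp
      rw [e1, mul_comm]
      refine (norm_add_le _ _).trans (add_le_add ?_ ?_)
      · exact (norm_apply_le_of_norm_le_one (hA1 b hb) _).trans (T.unit_le_opNorm x hx)
      · rw [norm_mul]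
        exact mul_le_mul (hr b hb hba) ((g - a.comp T).unit_le_opNorm x hx) (norm_nonneg _) hr0

/-- Nonzero operators into a space with property quasi-β are approximated by operators peaking
along functionals from a prescribed dense set, by means of two rank-one perturbations. -/
theorem HasPropertyQuasiBeta.exists_peaksAlong [Nontrivial X] [CompleteSpace Y]
    (hY : HasPropertyQuasiBeta 𝕜 Y) {T : X →L[𝕜] Y} (hT : T ≠ 0) {G : Set (StrongDual 𝕜 X)}
    (hG : Dense G) {ε : ℝ} (hε : 0 < ε) :
    ∃ (f f' : StrongDual 𝕜 X) (y y' : Y),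
      ‖(T + f.smulRight y + f'.smulRight y') - T‖ < ε ∧
      ∃ g ∈ G, g ≠ 0 ∧ PeaksAlong (T + f.smulRight y + f'.smulRight y') g := by
  obtain ⟨A, σ, ρ, hA, hσ, hext⟩ := hY
  have hnorming : ∀ y : Y, ∀ c : ℝ, (∀ b ∈ A, ‖b y‖ ≤ c) → ‖y‖ ≤ c := by
    intro y c hc
    obtain ⟨φ, hφ, hφy⟩ := exists_dualBallExtremePoints_apply_eq (𝕜 := 𝕜) y
    obtain ⟨Ae, hAe, ⟨t, ht, hcl⟩, -⟩ := hext φ hφ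
    have hclosed : IsClosed {ψ : WeakDual 𝕜 Y | ‖ψ y‖ ≤ c} :=
      isClosed_le (WeakDual.eval_continuous y).norm continuous_const
    have h1 : ‖t * φ y‖ ≤ c := closure_minimal (t := {ψ : WeakDual 𝕜 Y | ‖ψ y‖ ≤ c})
      (by rintro _ ⟨b, hb, rfl⟩; exact hc b (hAe hb)) hclosed hcl
    rw [norm_mul, ht, one_mul] at h1
    rw [← hφy]
    exact (RCLike.re_le_norm _).trans h1
  have hTn : 0 < ‖T‖ := norm_pos_iff.2 hT
  obtain ⟨f, y, hfy, e', he', hatt⟩ := exists_smulRight_adjoint_attains T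
    (ε := min (ε / 2) ‖T‖) (by positivity)
  set T₁ := T + f.smulRight y with hT₁
  have hT₁0 : 0 < ‖T₁‖ := by
    have h1 := norm_sub_le T₁ (f.smulRight y)
    rw [hT₁, add_sub_cancel_right, ← hT₁] at h1
    linarith [hfy.trans_le (min_le_right _ _)]
  set τ := ‖T₁‖ with hτ
  obtain ⟨Ae, hAe, ⟨t, ht, hcl⟩, r₀, hr₀, hρ⟩ := hext e' he'
  set r := max r₀ 0 with hr
  have hr0 : 0 ≤ r := le_max_right _ _
  have hr1 : 0 < 1 - r := by linarith [max_lt hr₀ one_pos]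
  obtain ⟨η, hη0, hη1, hηε⟩ : ∃ η : ℝ, 0 < η ∧ η ≤ 1 ∧ 2 * (η * τ) < ε / 2 := by
    refine ⟨min 1 (ε / (8 * τ)), by positivity, min_le_left _ _, ?_⟩
    calc 2 * (min 1 (ε / (8 * τ)) * τ) ≤ 2 * (ε / (8 * τ) * τ) := by
          gcongr; exact min_le_right _ _
      _ = ε / 4 := by field_simp; norm_num
      _ < ε / 2 := by linarith
  obtain ⟨δ, hδ0, hδ⟩ : ∃ δ : ℝ, 0 < δ ∧ 5 * δ = η * τ * (1 - r) :=
    ⟨η * τ * (1 - r) / 5, by positivity, by ring⟩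
  have hητ : 0 < η * τ := by positivity
  have hrητ : 0 ≤ η * τ * r := by positivity
  -- an element of `Ae` at which the adjoint of `T₁` almost attains its norm
  obtain ⟨a, ha, haT⟩ : ∃ a ∈ Ae, τ - δ < ‖a.comp T₁‖ := by
    obtain ⟨x, hx, hcx⟩ := exists_lt_norm_apply_of_lt_opNorm (e'.comp T₁) (c := τ - δ)
      (by rw [hatt]; linarith)
    have hmem : StrongDual.toWeakDual (t • e') ∈ {φ : WeakDual 𝕜 Y | τ - δ < ‖φ (T₁ x)‖} := by
      have h1 : τ - δ < ‖t * e' (T₁ x)‖ := by rw [norm_mul, ht, one_mul]; exact hcx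
      exact h1
    obtain ⟨_, haO, a, ha, rfl⟩ :=
      mem_closure_iff.1 hcl _ (isOpen_setOf_lt_norm_apply (T₁ x) (τ - δ)) hmem
    exact ⟨a, ha, lt_of_lt_of_le haO ((a.comp T₁).unit_le_opNorm x hx)⟩
  have haA := hAe ha
  have han : ‖a.comp T₁‖ ≤ τ := (a.opNorm_comp_le T₁).trans_eq (by rw [(hA a haA).1, one_mul])
  obtain ⟨g, hg, hgG⟩ := Metric.dense_iff.1 hG (((1 + η : ℝ) : 𝕜) • a.comp T₁) δ hδ0
  rw [Metric.mem_ball, dist_eq_norm] at hg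
  have hn : ‖((1 + η : ℝ) : 𝕜) • a.comp T₁‖ = (1 + η) * ‖a.comp T₁‖ := by
    rw [norm_smul, RCLike.norm_ofReal, abs_of_nonneg (by positivity)]
  have hgn : τ + η * τ - 3 * δ < ‖g‖ := by
    have h1 := norm_le_norm_add_norm_sub' (((1 + η : ℝ) : 𝕜) • a.comp T₁) g
    rw [norm_sub_rev, hn] at h1
    nlinarith
  have hga : ‖g - a.comp T₁‖ < η * τ + δ := by
    have e1 : g - a.comp T₁ = (g - ((1 + η : ℝ) : 𝕜) • a.comp T₁) + (η : 𝕜) • a.comp T₁ := by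
      ext x; simp; ring
    rw [e1]
    have h1 := norm_add_le (g - ((1 + η : ℝ) : 𝕜) • a.comp T₁) ((η : 𝕜) • a.comp T₁)
    have h2 : ‖(η : 𝕜) • a.comp T₁‖ ≤ η * τ := by
      rw [norm_smul, RCLike.norm_ofReal, abs_of_pos hη0]
      exact mul_le_mul_of_nonneg_left han hη0.le
    linarith
  refine ⟨f, g - a.comp T₁, y, σ a, ?_, g, hgG, norm_pos_iff.1 ?_, ?_⟩
  · have e1 : T₁ + (g - a.comp T₁).smulRight (σ a) - T
        = f.smulRight y + (g - a.comp T₁).smulRight (σ a) := by rw [hT₁]; abel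
    rw [e1]
    have h1 := norm_add_le (f.smulRight y) ((g - a.comp T₁).smulRight (σ a))
    rw [ContinuousLinearMap.norm_smulRight_apply (g - a.comp T₁), (hA a haA).2.1, mul_one] at h1
    linarith [hfy.trans_le (min_le_left _ _)]
  · nlinarith
  · refine peaksAlong_add_smulRight (fun b hb => (hA b hb).1.le) hnorming haA (hA a haA).2.2.1
      (r := r) (fun b hb hba => (hσ a haA b hb hba).trans ((hρ a ha).trans (le_max_left _ _)))
      hr0 ?_
    have h1 : r * ‖g - a.comp T₁‖ ≤ r * (η * τ + δ) := mul_le_mul_of_nonneg_left hga.le hr0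
    have h2 : r * δ ≤ δ := by nlinarith
    rw [← hτ]
    nlinarith

theorem isRSE_zero [Nontrivial X] : IsRSE (0 : X →L[𝕜] Y) := by
  obtain ⟨x, hx⟩ : ∃ x : X, ‖x‖ = 1 := by
    let _ := NormedSpace.restrictScalars ℝ 𝕜 X
    exact exists_norm_eq X zero_le_one
  exact ⟨x, hx, fun _ _ _ => ⟨id, strictMono_id, 1, by simp, by simp⟩⟩

theorem PeaksAlong.isRSE {R : X →L[𝕜] Y} {g : StrongDual 𝕜 X} (h : PeaksAlong R g) (hg0 : g ≠ 0)
    (hg : g ∈ smoothPoints 𝕜 (StrongDual 𝕜 X) ∩ normAttainingFunctionals 𝕜 X)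
    (hR : IsDunfordPettis R) : IsRSE R := by
  obtain ⟨x₀, hx₀, -, hx⟩ := h.exists_weakly_convergent_subseq hg0 hg.1 hg.2
  refine ⟨x₀, hx₀, fun x hx1 hlim => ?_⟩
  obtain ⟨s, hs, θ, hθ, hw⟩ := hx x hx1 hlim
  exact ⟨s, hs, θ, hθ, by simpa using hR _ _ hw⟩

end QuasiBeta

theorem OperatorIdeal.smulRight_mem {𝕜 : Type*} [RCLike 𝕜]
    {X : Type u} [NormedAddCommGroup X] [NormedSpace 𝕜 X] [CompleteSpace X]
    {Y : Type v} [NormedAddCommGroup Y] [NormedSpace 𝕜 Y] [CompleteSpace Y]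
    (I : OperatorIdeal.{u, v} 𝕜) (f : StrongDual 𝕜 X) (y : Y) :
    f.smulRight y ∈ I.component X Y := by
  refine I.finiteRank_mem X Y _ ?_
  refine Submodule.finiteDimensional_of_le (S₂ := Submodule.span 𝕜 {y}) ?_
  rintro _ ⟨x, rfl⟩
  exact Submodule.smul_mem _ _ (Submodule.mem_span_singleton_self y)

theorem OperatorIdeal.mem_closure_isRSE {𝕜 : Type*} [RCLike 𝕜]
    {X : Type u} [NormedAddCommGroup X] [NormedSpace 𝕜 X] [CompleteSpace X] [Nontrivial X]
    {Y : Type v} [NormedAddCommGroup Y] [NormedSpace 𝕜 Y] [CompleteSpace Y]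
    (hX : Dense (smoothPoints 𝕜 (StrongDual 𝕜 X) ∩ normAttainingFunctionals 𝕜 X))
    (hY : HasPropertyQuasiBeta 𝕜 Y) (I : OperatorIdeal.{u, v} 𝕜)
    (hI : ∀ S ∈ I.component X Y, IsDunfordPettis S) {T : X →L[𝕜] Y} (hT : T ∈ I.component X Y) :
    T ∈ closure {R : X →L[𝕜] Y | R ∈ I.component X Y ∧ IsRSE R} := by
  rcases eq_or_ne T 0 with rfl | hT0
  · exact subset_closure ⟨hT, isRSE_zero⟩
  rw [Metric.mem_closure_iff]
  intro ε hε
  obtain ⟨f, f', y, y', hR, g, hg, hg0, hpeak⟩ := hY.exists_peaksAlong hT0 hX hε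
  have hmem : T + f.smulRight y + f'.smulRight y' ∈ I.component X Y :=
    add_mem (add_mem hT (I.smulRight_mem f y)) (I.smulRight_mem f' y')
  exact ⟨_, ⟨hmem, hpeak.isRSE hg0 hg (hI _ hmem)⟩, by rwa [dist_comm, dist_eq_norm]⟩

/-! ### Subspaces of `c₀` -/

section CZero

open scoped ZeroAtInfty

variable {𝕜 : Type*} [RCLike 𝕜] {ι : Type*} [TopologicalSpace ι]

theorem norm_apply_le_norm_zeroAtInfty (z : C₀(ι, 𝕜)) (i : ι) : ‖z i‖ ≤ ‖z‖ :=
  z.toBCF.norm_coe_le_norm i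

theorem norm_zeroAtInfty_le {z : C₀(ι, 𝕜)} {C : ℝ} (hC : 0 ≤ C) (h : ∀ i, ‖z i‖ ≤ C) :
    ‖z‖ ≤ C :=
  (BoundedContinuousFunction.norm_le (f := z.toBCF) hC).2 h

/-- The `i`-th coordinate functional on `c₀`. -/
noncomputable def coordCZero (𝕜 : Type*) [RCLike 𝕜] {ι : Type*} [TopologicalSpace ι] (i : ι) :
    StrongDual 𝕜 C₀(ι, 𝕜) :=
  LinearMap.mkContinuous
    { toFun := fun z => z i
      map_add' := fun _ _ => rfl
      map_smul' := fun _ _ => rfl } 1 fun z => by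
    rw [one_mul]; exact z.toBCF.norm_coe_le_norm i

@[simp] theorem coordCZero_apply (i : ι) (z : C₀(ι, 𝕜)) : coordCZero 𝕜 i z = z i := rfl

variable [DiscreteTopology ι]

theorem finite_setOf_le_norm_apply (z : C₀(ι, 𝕜)) {ε : ℝ} (hε : 0 < ε) :
    {i | ε ≤ ‖z i‖}.Finite := by
  have h := z.zero_at_infty'.norm
  rw [norm_zero, cocompact_eq_cofinite] at h
  have h2 := h.eventually (gt_mem_nhds hε)
  rw [eventually_cofinite] at h2
  simpa using h2

open Classical in
/-- The projection of `c₀` that sets the coordinates outside `s` to zero. -/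
noncomputable def restrictCZero (𝕜 : Type*) [RCLike 𝕜] {ι : Type*} [TopologicalSpace ι]
    [DiscreteTopology ι] (s : Set ι) : C₀(ι, 𝕜) →L[𝕜] C₀(ι, 𝕜) :=
  LinearMap.mkContinuous
    { toFun := fun z =>
        { toFun := fun i => if i ∈ s then z i else 0
          continuous_toFun := continuous_of_discreteTopology
          zero_at_infty' := by
            refine squeeze_zero_norm (fun i => ?_) (tendsto_zero_iff_norm_tendsto_zero.1
              z.zero_at_infty')
            split_ifs
            · exact le_rfl
            · rw [norm_zero]; exact norm_nonneg _ }
      map_add' := fun z w => by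
        ext i
        change (if i ∈ s then z i + w i else 0) =
          (if i ∈ s then z i else 0) + if i ∈ s then w i else 0
        split_ifs <;> simp
      map_smul' := fun c z => by
        ext i
        change (if i ∈ s then c * z i else 0) = c * if i ∈ s then z i else 0
        split_ifs <;> simp } 1 fun z => by
    rw [one_mul]
    refine norm_zeroAtInfty_le (norm_nonneg _) fun i => ?_
    change ‖if i ∈ s then z i else 0‖ ≤ ‖z‖
    split_ifs
    · exact norm_apply_le_norm_zeroAtInfty z i
    · rw [norm_zero]; exact norm_nonneg _

open Classical in
theorem restrictCZero_apply (s : Set ι) (z : C₀(ι, 𝕜)) (i : ι) :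
    restrictCZero 𝕜 s z i = if i ∈ s then z i else 0 := rfl

open Classical in
/-- The `i`-th unit vector of `c₀`. -/
noncomputable def singleCZero (𝕜 : Type*) [RCLike 𝕜] {ι : Type*} [TopologicalSpace ι]
    [DiscreteTopology ι] (i : ι) : C₀(ι, 𝕜) where
  toFun := fun j => if j = i then 1 else 0
  continuous_toFun := continuous_of_discreteTopology
  zero_at_infty' := by
    rw [cocompact_eq_cofinite]
    refine tendsto_const_nhds.congr' ?_
    rw [EventuallyEq, eventually_cofinite]
    refine (Set.finite_singleton i).subset fun j hj => ?_
    by_contra hne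
    exact hj (if_neg hne).symm

open Classical in
theorem singleCZero_apply (i j : ι) : singleCZero 𝕜 i j = if j = i then 1 else 0 := rfl

theorem restrictCZero_add_compl (s : Set ι) (z : C₀(ι, 𝕜)) :
    restrictCZero 𝕜 s z + restrictCZero 𝕜 sᶜ z = z := by
  ext i
  rw [ZeroAtInftyContinuousMap.add_apply, restrictCZero_apply, restrictCZero_apply]
  by_cases h : i ∈ s <;> simp [h]

theorem restrictCZero_singleton (i : ι) (z : C₀(ι, 𝕜)) :
    restrictCZero 𝕜 {i} z = z i • singleCZero 𝕜 i := by
  ext j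
  rw [restrictCZero_apply, ZeroAtInftyContinuousMap.smul_apply, singleCZero_apply]
  by_cases h : j = i <;> simp [h]

/-- A nonzero functional on `c₀` cannot vanish at all unit vectors, as their span is dense. -/
theorem exists_apply_singleCZero_ne_zero {ψ : StrongDual 𝕜 C₀(ι, 𝕜)} (hψ : ψ ≠ 0) :
    ∃ i, ψ (singleCZero 𝕜 i) ≠ 0 := by
  by_contra! h
  refine hψ (ContinuousLinearMap.ext fun z => ?_)
  have hfin : ∀ s : Set ι, s.Finite → ψ (restrictCZero 𝕜 s z) = 0 := by
    intro s hs
    induction s, hs using Set.Finite.induction_on with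
    | empty =>
      have : restrictCZero 𝕜 ∅ z = 0 := by
        ext i; rw [restrictCZero_apply]; simp
      rw [this, map_zero]
    | @insert i s hi _ ih =>
      have : restrictCZero 𝕜 (insert i s) z = z i • singleCZero 𝕜 i + restrictCZero 𝕜 s z := by
        ext j
        rw [ZeroAtInftyContinuousMap.add_apply, ZeroAtInftyContinuousMap.smul_apply,
          restrictCZero_apply, restrictCZero_apply, singleCZero_apply]
        by_cases hj : j = i
        · subst hj; simp [hi]
        · have hmem : j ∈ insert i s ↔ j ∈ s := Set.mem_insert_iff.trans (or_iff_right hj)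
          by_cases hjs : j ∈ s
          · rw [if_pos (hmem.2 hjs), if_neg hj, if_pos hjs, smul_zero, zero_add]
          · rw [if_neg (mt hmem.1 hjs), if_neg hj, if_neg hjs, smul_zero, zero_add]
      rw [this, map_add, map_smul, h, ih, smul_zero, add_zero]
  rw [zero_apply, ← norm_le_zero_iff]
  refine le_of_forall_pos_le_add fun ε hε => ?_
  have hε' : 0 < ε / (‖ψ‖ + 1) := by positivity
  have h1 := hfin _ (finite_setOf_le_norm_apply z hε')
  rw [← restrictCZero_add_compl {i | ε / (‖ψ‖ + 1) ≤ ‖z i‖} z, map_add, h1, zero_add, zero_add]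
  refine (ψ.le_opNorm_of_le (norm_zeroAtInfty_le hε'.le fun i => ?_)).trans
    (b := ‖ψ‖ * (ε / (‖ψ‖ + 1))) ?_
  · rw [restrictCZero_apply]
    split_ifs with hi
    · exact le_of_not_ge hi
    · rw [norm_zero]; exact hε'.le
  · rw [← mul_div_assoc, div_le_iff₀ (by positivity)]
    nlinarith

/-- The dual of `c₀` is an `ℓ₁`-sum: splitting off one coordinate of a functional splits its
norm. -/
theorem norm_apply_single_add_le (ψ : StrongDual 𝕜 C₀(ι, 𝕜)) (i : ι) :
    ‖ψ (singleCZero 𝕜 i)‖ + ‖ψ.comp (restrictCZero 𝕜 {i}ᶜ)‖ ≤ ‖ψ‖ := by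
  have key : ∀ w : C₀(ι, 𝕜), ‖w‖ ≤ 1 →
      ‖ψ (singleCZero 𝕜 i)‖ + ‖ψ (restrictCZero 𝕜 {i}ᶜ w)‖ ≤ ‖ψ‖ := by
    intro w hw
    obtain ⟨θ, hθ, h⟩ := exists_norm_eq_one_mul_eq_norm (ψ (singleCZero 𝕜 i))
    obtain ⟨θ', hθ', h'⟩ := exists_norm_eq_one_mul_eq_norm (ψ (restrictCZero 𝕜 {i}ᶜ w))
    have hN : ‖θ • singleCZero 𝕜 i + θ' • restrictCZero 𝕜 {i}ᶜ w‖ ≤ 1 := by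
      refine norm_zeroAtInfty_le zero_le_one fun j => ?_
      rw [ZeroAtInftyContinuousMap.add_apply, ZeroAtInftyContinuousMap.smul_apply,
        ZeroAtInftyContinuousMap.smul_apply, restrictCZero_apply, singleCZero_apply]
      by_cases hj : j = i
      · simp [hj, hθ]
      · simpa [hj, hθ'] using (norm_apply_le_norm_zeroAtInfty w j).trans hw
    have h1 := ψ.unit_le_opNorm _ hN
    rw [map_add, map_smul, map_smul, smul_eq_mul, smul_eq_mul, h, h', ← RCLike.ofReal_add,
      RCLike.norm_ofReal, abs_of_nonneg (by positivity)] at h1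
    exact h1
  have h0 := key 0 (by simp)
  rw [map_zero, map_zero, norm_zero, add_zero] at h0
  have := opNorm_le_of_closedBall (T := ψ.comp (restrictCZero 𝕜 {i}ᶜ))
    (C := ‖ψ‖ - ‖ψ (singleCZero 𝕜 i)‖) (by linarith) fun w hw => by
      have := key w hw
      rw [ContinuousLinearMap.comp_apply]
      linarith
  linarith

variable {Y : Type*} [NormedAddCommGroup Y] [NormedSpace 𝕜 Y]

theorem norm_eq_one_of_mem_dualBallExtremePoints [Nontrivial Y] {e : StrongDual 𝕜 Y}
    (he : e ∈ dualBallExtremePoints 𝕜 Y) : ‖e‖ = 1 := by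
  have he1 : ‖e‖ ≤ 1 := by simpa using he.1
  rw [dualBallExtremePoints, mem_extremePoints] at he
  have he0 : e ≠ 0 := by
    rintro rfl
    obtain ⟨f, hf, -⟩ := exists_dual_vector' 𝕜 (0 : Y)
    have := (he.2 f (by simp [hf]) (-f) (by simp [hf])
      ⟨1 / 2, 1 / 2, by norm_num, by norm_num, by norm_num, by simp⟩).1
    rw [this] at hf
    simp at hf
  by_contra hne
  have hlt : ‖e‖ < 1 := lt_of_le_of_ne he1 hne
  have hpos : 0 < ‖e‖ := norm_pos_iff.2 he0
  have := (he.2 (‖e‖⁻¹ • e) (by simp [norm_smul, hpos.ne']) 0 (by simp)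
    ⟨‖e‖, 1 - ‖e‖, hpos, by linarith, by ring, by
      ext y; simp [hpos.ne']⟩).2
  exact he0 this.symm

/-- An extreme point of the dual ball is proportional to the summands of any decomposition that
is additive for the norms. -/
theorem eq_smul_of_mem_dualBallExtremePoints {e u v : StrongDual 𝕜 Y}
    (he : e ∈ dualBallExtremePoints 𝕜 Y) (he1 : ‖e‖ = 1) (huv : e = u + v) {α β : ℝ} (hα : 0 < α)
    (hu : ‖u‖ ≤ α) (hv : ‖v‖ ≤ β) (hαβ : α + β ≤ 1) : e = α⁻¹ • u := by
  have hsum : α + β = 1 := by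
    refine le_antisymm hαβ ?_
    rw [← he1, huv]
    exact (norm_add_le _ _).trans (add_le_add hu hv)
  have hβ0 : 0 ≤ β := (norm_nonneg _).trans hv
  rcases hβ0.eq_or_lt with rfl | hβ
  · have hv0 : v = 0 := norm_le_zero_iff.1 hv
    have hα1 : α = 1 := by linarith
    rw [huv, hv0, hα1, inv_one, one_smul, add_zero]
  · rw [dualBallExtremePoints, mem_extremePoints] at he
    have hb : ∀ {w : StrongDual 𝕜 Y} {γ : ℝ}, 0 < γ → ‖w‖ ≤ γ →
        γ⁻¹ • w ∈ Metric.closedBall (0 : StrongDual 𝕜 Y) 1 := by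
      intro w γ hγ hw
      rw [mem_closedBall_zero_iff, norm_smul, norm_inv, Real.norm_of_nonneg hγ.le,
        inv_mul_le_iff₀ hγ, mul_one]
      exact hw
    exact (he.2 _ (hb hα hu) _ (hb hβ hv) ⟨α, β, hα, hβ, hsum, by
      rw [smul_smul, smul_smul, mul_inv_cancel₀ hα.ne', mul_inv_cancel₀ hβ.ne', one_smul,
        one_smul, huv]⟩).1.symm

/-- A functional dominated by the norm of `Φ y` factors through `Φ` with norm at most one. -/
theorem exists_comp_eq_of_norm_le {Z : Type*} [NormedAddCommGroup Z] [NormedSpace 𝕜 Z]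
    {Φ : Y →L[𝕜] Z} {e : StrongDual 𝕜 Y} (h : ∀ y, ‖e y‖ ≤ ‖Φ y‖) :
    ∃ ψ : StrongDual 𝕜 Z, ‖ψ‖ ≤ 1 ∧ ψ.comp Φ = e := by
  obtain ⟨s, hs⟩ := (Φ : Y →ₗ[𝕜] Z).rangeRestrict.exists_rightInverse_of_surjective
    (LinearMap.range_rangeRestrict _)
  have hs' : ∀ z, Φ (s z) = z := fun z => congrArg Subtype.val (DFunLike.congr_fun hs z)
  obtain ⟨ψ, hψ, hψn⟩ := exists_extension_norm_eq _ (((e : Y →ₗ[𝕜] 𝕜).comp s).mkContinuous 1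
    fun z => by
      rw [one_mul]
      exact (h (s z)).trans_eq (by rw [hs' z]; rfl))
  refine ⟨ψ, hψn.trans_le (LinearMap.mkContinuous_norm_le _ zero_le_one _), ?_⟩
  ext y
  have h1 : ψ (Φ y) = e (s ⟨Φ y, y, rfl⟩) := hψ ⟨Φ y, y, rfl⟩
  have h2 : ‖e (s ⟨Φ y, y, rfl⟩ - y)‖ ≤ 0 :=
    (h _).trans_eq (by rw [map_sub, hs', sub_self, norm_zero])
  rw [norm_le_zero_iff, map_sub, sub_eq_zero] at h2
  rw [ContinuousLinearMap.comp_apply, h1, h2]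

/-- An extreme functional dominated by the supremum of the coordinates of an operator into `c₀`
is a rotation of one of the coordinates. -/
theorem exists_eq_smul_coord_of_norm_le {Φ : Y →L[𝕜] C₀(ι, 𝕜)} (hΦ : ‖Φ‖ ≤ 1)
    {e : StrongDual 𝕜 Y} (he : e ∈ dualBallExtremePoints 𝕜 Y) (he1 : ‖e‖ = 1)
    (h : ∀ y, ‖e y‖ ≤ ‖Φ y‖) :
    ∃ (i : ι) (t : 𝕜), ‖t‖ = 1 ∧ e = t • (coordCZero 𝕜 i).comp Φ := by
  obtain ⟨ψ, hψ, hψe⟩ := exists_comp_eq_of_norm_le h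
  have hψ0 : ψ ≠ 0 := by
    rintro rfl
    rw [ContinuousLinearMap.zero_comp] at hψe
    rw [← hψe, norm_zero] at he1
    exact zero_ne_one he1
  obtain ⟨i, hi⟩ := exists_apply_singleCZero_ne_zero hψ0
  set c := ψ (singleCZero 𝕜 i) with hc
  have hcn : ‖c‖ ≠ 0 := norm_ne_zero_iff.2 hi
  have hsplit := norm_apply_single_add_le ψ i
  have e1 : e = c • (coordCZero 𝕜 i).comp Φ + (ψ.comp (restrictCZero 𝕜 {i}ᶜ)).comp Φ := by
    ext y
    rw [← hψe, ContinuousLinearMap.comp_apply]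
    conv_lhs => rw [← restrictCZero_add_compl {i} (Φ y), restrictCZero_singleton, map_add, map_smul]
    simp [hc, mul_comm]
  have hi1 : ‖c • (coordCZero 𝕜 i).comp Φ‖ ≤ ‖c‖ := by
    rw [norm_smul]
    refine mul_le_of_le_one_right (norm_nonneg _) (opNorm_le_of_closedBall zero_le_one fun y hy => ?_)
    exact (norm_apply_le_norm_zeroAtInfty _ _).trans
      ((norm_apply_le_of_norm_le_one hΦ y).trans hy)
  have h2 := eq_smul_of_mem_dualBallExtremePoints he he1 e1 (norm_pos_iff.2 hi) hi1
    ((ContinuousLinearMap.opNorm_comp_le _ _).trans (mul_le_of_le_one_right (norm_nonneg _) hΦ))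
    (hsplit.trans hψ)
  refine ⟨i, (‖c‖⁻¹ : ℝ) • c, by rw [norm_smul]; simp [hcn], ?_⟩
  rw [h2]
  ext y
  simp

/-- In a subspace of `c₀`, every extreme functional is strictly larger at some vector than all
coordinates that are not rotations of it. -/
theorem exists_peak_vector [Nontrivial Y] (J : Y →ₗᵢ[𝕜] C₀(ι, 𝕜)) {e : StrongDual 𝕜 Y}
    (he : e ∈ dualBallExtremePoints 𝕜 Y) :
    ∃ (y : Y) (r : ℝ), ‖y‖ = 1 ∧ e y = 1 ∧ r < 1 ∧
      ∀ b ∈ dualBallExtremePoints 𝕜 Y, (¬ ∃ t : 𝕜, ‖t‖ = 1 ∧ b = t • e) → ‖b y‖ ≤ r := by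
  have he1 := norm_eq_one_of_mem_dualBallExtremePoints he
  have hJn : ‖J.toContinuousLinearMap‖ ≤ 1 := J.norm_toContinuousLinearMap_le
  -- the coordinates that are not rotations of `e`
  let s : Set ι := {i | ¬ ∃ t : 𝕜, ‖t‖ = 1 ∧ e = t • (coordCZero 𝕜 i).comp J.toContinuousLinearMap}
  let Φ : Y →L[𝕜] C₀(ι, 𝕜) := (restrictCZero 𝕜 s).comp J.toContinuousLinearMap
  have hrestrict : ‖restrictCZero 𝕜 s‖ ≤ 1 := LinearMap.mkContinuous_norm_le _ zero_le_one _
  have hΦn : ‖Φ‖ ≤ 1 := (ContinuousLinearMap.opNorm_comp_le _ _).trans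
    (mul_le_one₀ hrestrict (norm_nonneg _) hJn)
  have hΦs : ∀ i ∈ s, ∀ y, Φ y i = J y i := fun i hi y => if_pos hi
  obtain ⟨y, hy⟩ : ∃ y, ‖Φ y‖ < ‖e y‖ := by
    by_contra! h
    obtain ⟨i, t, ht, hit⟩ := exists_eq_smul_coord_of_norm_le hΦn he he1 h
    by_cases hi : i ∈ s
    · refine hi ⟨t, ht, hit.trans ?_⟩
      congr 1
      ext y
      exact hΦs i hi y
    · have h0 : e = 0 := by
        rw [hit]
        ext y
        have : Φ y i = 0 := if_neg hi
        simp [this]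
      rw [h0, norm_zero] at he1
      exact zero_ne_one he1
  have hey : e y ≠ 0 := norm_pos_iff.1 ((norm_nonneg _).trans_lt hy)
  have hyn : ‖y‖ = ‖e y‖ := by
    refine le_antisymm ?_ (norm_apply_le_of_norm_le_one he1.le y)
    rw [← J.norm_map]
    refine norm_zeroAtInfty_le (norm_nonneg _) fun i => ?_
    by_cases hi : i ∈ s
    · rw [← hΦs i hi]
      exact (norm_apply_le_norm_zeroAtInfty _ _).trans hy.le
    · obtain ⟨t, ht, hit⟩ := not_not.1 hi
      rw [hit, smul_apply, norm_smul, ht, one_mul]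
      exact le_rfl
  have heyn : 0 < ‖e y‖ := norm_pos_iff.2 hey
  refine ⟨(e y)⁻¹ • y, ‖Φ y‖ / ‖e y‖, ?_, ?_, (div_lt_one heyn).2 hy, fun b hb hbe => ?_⟩
  · rw [norm_smul, norm_inv, hyn, inv_mul_cancel₀ heyn.ne']
  · rw [map_smul, smul_eq_mul, inv_mul_cancel₀ hey]
  · obtain ⟨i, t, ht, hit⟩ := exists_eq_smul_coord_of_norm_le hJn hb
      (norm_eq_one_of_mem_dualBallExtremePoints hb)
      (fun y => (norm_apply_le_of_norm_le_one
        (norm_eq_one_of_mem_dualBallExtremePoints hb).le y).trans_eq (J.norm_map y).symm)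
    have hi : i ∈ s := by
      rintro ⟨t', ht', hit'⟩
      have ht0 : t' ≠ 0 := norm_ne_zero_iff.1 (by rw [ht']; exact one_ne_zero)
      refine hbe ⟨t * t'⁻¹, by simp [ht, ht'], ?_⟩
      rw [hit, hit']
      ext y
      simp only [smul_apply, smul_eq_mul, ContinuousLinearMap.comp_apply]
      field_simp
    have h1 : ‖b y‖ ≤ ‖Φ y‖ := by
      have h2 : b y = t * Φ y i := by rw [hΦs i hi, hit]; rfl
      rw [h2, norm_mul, ht, one_mul]
      exact norm_apply_le_norm_zeroAtInfty _ _
    rw [map_smul, norm_smul, norm_inv, inv_mul_eq_div]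
    exact div_le_div_of_nonneg_right h1 heyn.le

/-- Proportionality by a scalar of modulus one. -/
def rotationSetoid (𝕜 : Type*) [RCLike 𝕜] (E : Type*) [AddCommGroup E] [Module 𝕜 E] :
    Setoid E where
  r a b := ∃ t : 𝕜, ‖t‖ = 1 ∧ a = t • b
  iseqv :=
    { refl := fun a => ⟨1, norm_one, (one_smul _ _).symm⟩
      symm := by
        rintro _ b ⟨t, ht, rfl⟩
        have h0 : t ≠ 0 := norm_ne_zero_iff.1 (by rw [ht]; exact one_ne_zero)
        exact ⟨t⁻¹, by simp [ht], by rw [smul_smul, inv_mul_cancel₀ h0, one_smul]⟩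
      trans := by
        rintro _ _ c ⟨t, ht, rfl⟩ ⟨t', ht', rfl⟩
        exact ⟨t * t', by simp [ht, ht'], by rw [smul_smul]⟩ }

theorem smul_mem_dualBallExtremePoints {e : StrongDual 𝕜 Y} (he : e ∈ dualBallExtremePoints 𝕜 Y)
    {t : 𝕜} (ht : ‖t‖ = 1) : t • e ∈ dualBallExtremePoints 𝕜 Y := by
  have h0 : t ≠ 0 := norm_ne_zero_iff.1 (by rw [ht]; exact one_ne_zero)
  refine ⟨by simpa [norm_smul, ht] using he.1, ?_⟩
  rintro u hu v hv ⟨a, b, ha, hb, hab, h⟩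
  have h1 := he.2 (x₁ := t⁻¹ • u) (by simpa [norm_smul, ht] using hu) (x₂ := t⁻¹ • v)
    (by simpa [norm_smul, ht] using hv) ⟨a, b, ha, hb, hab, by
      have h2 : a • t⁻¹ • u + b • t⁻¹ • v = t⁻¹ • (a • u + b • v) := by
        rw [smul_add, smul_comm a, smul_comm b]
      rw [h2, h, smul_smul, inv_mul_cancel₀ h0, one_smul]⟩
  rw [← h1, smul_smul, mul_inv_cancel₀ h0, one_smul]

/-- Subspaces of `c₀` have property quasi-β, with one representative from each rotation class of
extreme functionals. -/
theorem hasPropertyQuasiBeta_of_linearIsometry [Nontrivial Y] (J : Y →ₗᵢ[𝕜] C₀(ι, 𝕜)) :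
    HasPropertyQuasiBeta 𝕜 Y := by
  let rep : StrongDual 𝕜 Y → StrongDual 𝕜 Y := fun e =>
    (Quotient.mk (rotationSetoid 𝕜 (StrongDual 𝕜 Y)) e).out
  have hrep : ∀ e, ∃ t : 𝕜, ‖t‖ = 1 ∧ rep e = t • e := fun e =>
    Quotient.mk_out (s := rotationSetoid 𝕜 (StrongDual 𝕜 Y)) e
  have hrep_eq : ∀ a b, (∃ t : 𝕜, ‖t‖ = 1 ∧ a = t • b) → rep a = rep b := fun a b h =>
    congrArg Quotient.out (Quotient.sound (s := rotationSetoid 𝕜 (StrongDual 𝕜 Y)) h)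
  choose! σ ρ hσ1 hσ hρ hother using
    fun (e : StrongDual 𝕜 Y) (he : e ∈ dualBallExtremePoints 𝕜 Y) => exists_peak_vector J he
  refine ⟨{a | a ∈ dualBallExtremePoints 𝕜 Y ∧ rep a = a}, σ, ρ, ?_, ?_, ?_⟩
  · rintro a ⟨ha, -⟩
    exact ⟨norm_eq_one_of_mem_dualBallExtremePoints ha, hσ1 a ha, hσ a ha, hρ a ha⟩
  · rintro a ⟨ha, hra⟩ b ⟨hb, hrb⟩ hba
    refine hother a ha b hb fun h => hba ?_
    rw [← hra, ← hrb, hrep_eq b a h]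
  · intro e he
    obtain ⟨t, ht, hte⟩ := hrep e
    have hext : rep e ∈ dualBallExtremePoints 𝕜 Y := by
      rw [hte]; exact smul_mem_dualBallExtremePoints he ht
    refine ⟨{rep e}, ?_, ⟨t, ht, subset_closure ⟨rep e, rfl, by rw [hte]⟩⟩, ρ (rep e),
      hρ _ hext, ?_⟩
    · rintro _ rfl
      exact ⟨hext, hrep_eq _ _ (hrep e)⟩
    · rintro _ rfl
      exact le_rfl

end CZero

theorem theorem4p1 {𝕜 : Type*} [RCLike 𝕜]
    {X : Type u} [NormedAddCommGroup X] [NormedSpace 𝕜 X] [CompleteSpace X] [Nontrivial X]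
    {Y : Type v} [NormedAddCommGroup Y] [NormedSpace 𝕜 Y] [CompleteSpace Y] :
    -- operators into spaces with quasi-ACK structure
    (∀ (Γ : Set (StrongDual 𝕜 Y)) (ρ : StrongDual 𝕜 Y → ℝ), HasQuasiACKStructure Γ ρ →
      ∀ T : X →L[𝕜] Y, (∀ Γ₀ ⊆ Γ, IsFlat T Γ₀) →
        (Dense (stronglyExposingFunctionals (𝕜 := 𝕜) (Metric.closedBall (0 : X) 1)) →
          ∀ ε : ℝ, 0 < ε → ∃ R : X →L[𝕜] Y, IsASE R ∧ ‖R - T‖ < ε) ∧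
        (Dense (smoothPoints 𝕜 (StrongDual 𝕜 X) ∩ normAttainingFunctionals 𝕜 X) →
          ∀ ε : ℝ, 0 < ε → ∃ R : X →L[𝕜] Y, ‖R - T‖ < ε ∧
            ∃ x₀ : X, ‖x₀‖ = 1 ∧ ‖R x₀‖ = ‖R‖ ∧
              ∀ x : ℕ → X, (∀ n, ‖x n‖ ≤ 1) →
                Tendsto (fun n => ‖R (x n)‖) atTop (𝓝 ‖R‖) →
                ∃ s : ℕ → ℕ, StrictMono s ∧ ∃ θ : 𝕜, ‖θ‖ = 1 ∧
                  WeaklyConvergesTo 𝕜 (fun n => x (s n)) (θ • x₀))) ∧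
    -- ideals of Dunford-Pettis operators into spaces with property quasi-β
    (Dense (smoothPoints 𝕜 (StrongDual 𝕜 X) ∩ normAttainingFunctionals 𝕜 X) →
      HasPropertyQuasiBeta 𝕜 Y →
      ∀ I : OperatorIdeal.{u, v} 𝕜, (∀ S ∈ I.component X Y, IsDunfordPettis S) →
        ∀ T ∈ I.component X Y, T ∈ closure {R : X →L[𝕜] Y | R ∈ I.component X Y ∧ IsRSE R}) ∧
    -- closed subspaces of `c₀(ι)`, given by an isometric embedding
    (∀ (ι : Type*) [TopologicalSpace ι] [DiscreteTopology ι],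
      (Y →ₗᵢ[𝕜] ZeroAtInftyContinuousMap ι 𝕜) →
      (Nontrivial Y → HasPropertyQuasiBeta 𝕜 Y) ∧
      (Dense (smoothPoints 𝕜 (StrongDual 𝕜 X) ∩ normAttainingFunctionals 𝕜 X) →
        ∀ I : OperatorIdeal.{u, v} 𝕜, (∀ S ∈ I.component X Y, IsDunfordPettis S) →
          ∀ T ∈ I.component X Y,
            T ∈ closure {R : X →L[𝕜] Y | R ∈ I.component X Y ∧ IsRSE R})) := by
  refine ⟨fun Γ ρ hY T hT => ⟨fun hX ε hε => ?_, fun hX ε hε => ?_⟩,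
    fun hX hY I hI T hT => I.mem_closure_isRSE hX hY hI hT,
    fun ι _ _ J => ⟨fun _ => hasPropertyQuasiBeta_of_linearIsometry J, fun hX I hI T hT => ?_⟩⟩
  · obtain ⟨R, hRT, g, hg, -, hpeak⟩ := hY.exists_peaksAlong hT hX hε
    exact ⟨R, hpeak.isASE hg, hRT⟩
  · obtain ⟨R, hRT, g, hg, hg0, hpeak⟩ := hY.exists_peaksAlong hT hX hε
    exact ⟨R, hRT, hpeak.exists_weakly_convergent_subseq hg0 hg.1 hg.2⟩
  · rcases subsingleton_or_nontrivial Y with hY | hY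
    · obtain rfl : T = 0 := ContinuousLinearMap.ext fun x => Subsingleton.elim _ _
      exact subset_closure ⟨hT, isRSE_zero⟩
    · exact I.mem_closure_isRSE hX (hasPropertyQuasiBeta_of_linearIsometry J) hI hT
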